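/- **Data.** Let $n\ge 1$, $d,B\ge 0$. Let $(X_i,T_i,C_i)_{i=1}^n$ be random variables with covariates $X_i\in\mathbb R^d$, lifetimes $T_i\ge 0$ and censoring times $C_i\ge0$. Write $X=(X_1,\dots,X_n)$; its law is arbitrary, in particular $X$ may be deterministic. Assume that, conditionally on $X$, the pairs $(T_1,C_1),\dots,(T_n,C_n)$ are mutually independent and, for each $i$, $T_i$ and $C_i$ are independent. The observed data are $D=\{(X_i,Z_i,\Delta_i)\}_{i=1}^n$ with $Z_i=\min\{T_i,C_i\}$ and $\Delta_i=1\{C_i>T_i\}$. **Transformation (OPT).** List the individuals in order of increasing $Z_i$, ties being ordered uniformly at random. Start with $AR=L=$ the multiset of all covariates. Process the individuals $i$ in this order. If $\Delta_i=1$, take a coupling of a uniform pick from $AR$ and a uniform pick from $L$ that minimizes the expected Euclidean distance between the two picks (optimal couplings being selected by any fixed rule, depending measurably on the covariates, the multisets being represented by index sets); draw $y$ from the conditional law of the second pick given that the first pick is $X_i$; put $(y,Z_i)$ into $\tilde D$ and delete one instance of $y$ (the one drawn) from $L$. Whatever $\Delta_i$ is, then delete $X_i$ from $AR$. At the end, for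 every $y$ left in $L$ put $(y,\max_j Z_j)$ into $\tilde D$. Given the data, the random choices made are independent of the unobserved parts of the $(T_i,C_i)$. Thus $\tilde D=\{(X_j,\tilde t_j)\}_{j=1}^n$ is an (unordered) dataset that assigns a time $\tilde t_j$ to each covariate. **Test.** Let $\pi_1,\dots,\pi_B$ be independent uniform random permutations of $\{1,\dots,n\}$, independent of everything above, and put $\pi(\tilde D)=\{(X_{\pi(j)},\tilde t_j)\}_{j=1}^n$. Let $H$ be any measurable real-valued statistic of unordered datasets (multisets of $n$ pairs), and let $R\in\{1,\dots,B+1\}$ be the rank, in increasing order and with ties broken uniformly at random (independently of everything else), of the first coordinate of $$\bigl(H(\tilde D),H(\pi_1(\tilde D)),\dots,H(\pi_B(\tilde D))\bigr).$$ **Theorem.** Assume the null hypothesis $H_0: X\perp T$ and that the censoring is independent of the covariate, $C\perp X$; that is, each $T_i$ is independent of $(X_1,\dots,X_n)$ and $T_1,\dots,T_n$ are identically distributed, and likewise for $C_1,\dots,C_n$. Then for every $\alpha\in[0,1]$ $$P\bigl(R\ge(1-\alpha)(B+1)+1\bigr)=\frac{\lfloor\alpha(B+1)\rfloor}{B+1}\le\alpha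 ,$$ and the same equality holds almost surely for the conditional probability given $(X_1,\dots,X_n)$. -/

import Mathlib

open MeasureTheory ProbabilityTheory
open scoped ENNReal NNReal

namespace OPTTest

/-- The covariate space `ℝ^d`, with its Euclidean distance and Borel sigma-algebra. -/
abbrev Cov (d : ℕ) : Type := EuclideanSpace ℝ (Fin d)

/-- Permutations of a finite index set carry the discrete sigma-algebra. -/
instance instMeasurableSpacePermFin (n : ℕ) : MeasurableSpace (Equiv.Perm (Fin n)) := ⊤

section Censoring

variable {n : ℕ}

/-- The observed times `z i = min (t i) (c i)`. -/
noncomputable def obsTime (t c : Fin n → ℝ≥0) : Fin n → ℝ≥0 := fun i => min (t i) (c i)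

/-- The event indicators: `true` (the event is observed) iff `c i > t i`. -/
noncomputable def obsEvent (t c : Fin n → ℝ≥0) : Fin n → Bool := fun i => decide (t i < c i)

/-- The lifetimes (or the censoring times) `Y 1, …, Y n` are independent of the covariates: each
`Y i` is independent of the covariates, and the law of `Y i` is the same for all individuals.
In other words, the conditional law of `Y i` given the covariates is one fixed law, whatever the
covariates are. The covariates may be random (if the `(X i, Y i)` are i.i.d., this says
that `X 1` and `Y 1` are independent) or deterministic (then this says that the law of `Y i` does
not depend on the value of the `i`-th covariate). -/
def IndepOfCovariate {Ω E : Type*} [MeasurableSpace Ω] [MeasurableSpace E] (P : Measure Ω)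
    (X : Ω → Fin n → E) (Y : Ω → Fin n → ℝ≥0) : Prop :=
  (∀ i, IndepFun X (fun ω => Y ω i) P) ∧
    ∀ i j, IdentDistrib (fun ω => Y ω i) (fun ω => Y ω j) P P

end Censoring

section Coupling

variable {n d : ℕ}

/-- `Q` is a coupling of a uniform pick from the index set `A` (first coordinate) and a uniform
pick from the index set `L` (second coordinate). Picking an index uniformly is the same as picking
a covariate uniformly from the multiset of covariates with index in the set. -/
def IsUniformCoupling (A L : Finset (Fin n)) (hA : A.Nonempty) (hL : L.Nonempty)
    (Q : PMF (Fin n × Fin n)) : Prop :=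
  Q.map Prod.fst = PMF.uniformOfFinset A hA ∧ Q.map Prod.snd = PMF.uniformOfFinset L hL

/-- The expected distance between the two covariates picked by `Q`. -/
noncomputable def transportCost (x : Fin n → Cov d) (Q : PMF (Fin n × Fin n)) : ℝ :=
  ∑ p : Fin n × Fin n, (Q p).toReal * dist (x p.2) (x p.1)

/-- `Q` is an optimal transport coupling of the two uniform picks. -/
def IsOptimalCoupling (x : Fin n → Cov d) (A L : Finset (Fin n)) (hA : A.Nonempty)
    (hL : L.Nonempty) (Q : PMF (Fin n × Fin n)) : Prop :=
  IsUniformCoupling A L hA hL Q ∧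
    ∀ Q', IsUniformCoupling A L hA hL Q' → transportCost x Q ≤ transportCost x Q'

open Classical in
/-- The conditional law of the second coordinate under `Q` given that the first one is `i`
(with the arbitrary value `pure i` if the first coordinate is `i` with probability zero). -/
noncomputable def condPick (Q : PMF (Fin n × Fin n)) (i : Fin n) : PMF (Fin n) :=
  if h : ∑' j, Q (i, j) = 0 then PMF.pure i
  else PMF.normalize (fun j => Q (i, j)) h (by
    rw [tsum_fintype]
    exact ENNReal.sum_ne_top.mpr fun j _ => PMF.apply_ne_top Q (i, j))

/-- A rule which solves the optimal transport problems: for each covariate vector `x`, and each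
pair of nonempty index sets, it selects an optimal coupling (optimal couplings need not be
unique), and depends measurably on `x`. -/
structure IsOptimalPlan
    (plan : (Fin n → Cov d) → Finset (Fin n) → Finset (Fin n) → PMF (Fin n × Fin n)) : Prop where
  measurable : ∀ A L p, Measurable fun x => plan x A L p
  optimal : ∀ x A L (hA : A.Nonempty) (hL : L.Nonempty),
    IsOptimalCoupling x A L hA hL (plan x A L)

end Coupling

section Transformation

variable {n d : ℕ}

/-- The individuals listed in order of their observed time `z`; ties are broken by `ρ`. -/
noncomputable def timeOrder (z : Fin n → ℝ≥0) (ρ : Equiv.Perm (Fin n)) : List (Fin n) :=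
  List.ofFn fun k => Tuple.sort (fun i => toLex (z i, ρ i)) k

/-- The main loop of the transformation, for couplings `Q A L` and event indicators `δ`. The
arguments are the individuals still to be processed (in order of time), the index set `A` of the
covariates at risk in the original data, the index set `L` of the covariates at risk in the
synthetic data, and the current assignment `a`. At an observed event `i`, a covariate
`j ∈ L` is drawn from the coupling conditionally on the first pick being `i`; it gets the event time
of `i` (recorded as `a j = i`), and is deleted from `L`. In any case `i` is deleted from `A`. -/
noncomputable def transformLoop (Q : Finset (Fin n) → Finset (Fin n) → PMF (Fin n × Fin n))
    (δ : Fin n → Bool) :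
    List (Fin n) → Finset (Fin n) → Finset (Fin n) → (Fin n → Fin n) → PMF (Fin n → Fin n)
  | [], _, _, a => PMF.pure a
  | i :: l, A, L, a =>
    if δ i = true then
      (condPick (Q A L) i).bind fun j =>
        transformLoop Q δ l (A.erase i) (L.erase j) (Function.update a j i)
    else transformLoop Q δ l (A.erase i) L a

/-- The law of the output of the transformation of the data `(x i, z i, δ i)`: a random assignment
`a`, meaning that in the synthetic data the covariate `x j` gets the time `z (a j)`. Ties between the
observed times are ordered uniformly at random. All covariates that are not drawn at
some observed event get the last observed time. -/
noncomputable def transformLaw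
    (plan : (Fin n → Cov d) → Finset (Fin n) → Finset (Fin n) → PMF (Fin n × Fin n))
    (x : Fin n → Cov d) (z : Fin n → ℝ≥0) (δ : Fin n → Bool) : PMF (Fin n → Fin n) :=
  (PMF.uniformOfFintype (Equiv.Perm (Fin n))).bind fun ρ =>
    transformLoop (plan x) δ (timeOrder z ρ) Finset.univ Finset.univ
      fun j => (timeOrder z ρ).getLastD j

end Transformation

section PermutationTest

variable {n d : ℕ}

/-- The (unordered) dataset of the pairs `(x j, t j)`, as a multiset. -/
def dataset (x : Fin n → Cov d) (t : Fin n → ℝ≥0) : Multiset (Cov d × ℝ≥0) :=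
  Finset.univ.val.map fun j => (x j, t j)

/-- The vector of the value of the statistic `H` on the dataset `(x j, t j)`, followed by
its values on the permuted datasets `(x (π b j), t j)`. -/
def testVector {B : ℕ} (H : Multiset (Cov d × ℝ≥0) → ℝ) (x : Fin n → Cov d)
    (t : Fin n → ℝ≥0) (π : Fin B → Equiv.Perm (Fin n)) : Fin (B + 1) → ℝ :=
  Fin.cons (H (dataset x t)) fun b => H (dataset (x ∘ π b) t)

open Classical in
/-- The rank (from `1` to `B + 1`, in increasing order) of the first coordinate of `h`,
where ties are broken by `σ`. -/
noncomputable def rankFirst {B : ℕ} (h : Fin (B + 1) → ℝ) (σ : Equiv.Perm (Fin (B + 1))) : ℕ :=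
  (Finset.univ.filter fun j => h j < h 0 ∨ (h j = h 0 ∧ σ j ≤ σ 0)).card

end PermutationTest

end OPTTest

/-! The test is exact once the assigned times are exchangeable given the covariates, and this
exchangeability comes from the marginals of the couplings.

Under the hypotheses the pairs `(T i, C i)` are i.i.d. given `X` (`map_prodMk_eq`), so the observed
pairs (time, indicator) may be rearranged by a uniform permutation without changing the joint law
with `X` (`map_comp_perm_eq`). Fix the sorted list of these pairs: the individuals that carry them
then appear in a uniformly random order. At an event the current individual is therefore uniform on
the risk set `A`, and since the coupling has uniform marginals, the second pick is uniform on `L`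
(`IsUniformCoupling.sum_condPick`). The pick does depend on the individual, but by induction the
averaged future depends on the remaining `L` alone, so the dependence does no harm
(`sum_labelLoop`). On average the transformation thus hands out the times by uniform draws without
replacement, which treats all indices alike (`sum_perm_transformLaw_comp`).

For the test, permuting covariates in an unordered dataset amounts to permuting times inversely. If
the times are first rearranged by a uniform `h`, the `B + 1` datasets correspond to the permutations
`h, h * (π 1)⁻¹, …, h * (π B)⁻¹`, which are independent and uniform. Their statistics are
exchangeable, so with random tie breaking each rank has probability `1 / (B + 1)`
(`card_rankFirst_testVector`, `measure_rankFirst_eq`). The proof works on the events `X ⁻¹' E`,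
which yields the conditional statement as well. -/

namespace OPTTest

/-! ### Combinatorics of ranks and of the permutation test -/

section Rank

open Classical in
/-- The rank (in increasing order) of the coordinate `j` of `h`, where ties are broken by `σ`. -/
noncomputable def rankAt {m : ℕ} (h : Fin m → ℝ) (σ : Equiv.Perm (Fin m)) (j : Fin m) : ℕ :=
  (Finset.univ.filter fun i => h i < h j ∨ (h i = h j ∧ σ i ≤ σ j)).card

theorem rankFirst_eq_rankAt {B : ℕ} (h : Fin (B + 1) → ℝ) (σ : Equiv.Perm (Fin (B + 1))) :
    rankFirst h σ = rankAt h σ 0 := rfl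

theorem rankAt_comp {m : ℕ} (h : Fin m → ℝ) (σ s : Equiv.Perm (Fin m)) (j : Fin m) :
    rankAt (h ∘ s) (s.trans σ) j = rankAt h σ (s j) := by
  classical
  unfold rankAt
  refine Finset.card_bij (fun i _ => s i) ?_ ?_ ?_
  · intro i hi
    exact Finset.mem_filter.mpr ⟨Finset.mem_univ _, (Finset.mem_filter.mp hi).2⟩
  · intro i _ i' _ hii
    exact s.injective hii
  · intro i hi
    refine ⟨s.symm i, ?_, s.apply_symm_apply i⟩
    refine Finset.mem_filter.mpr ⟨Finset.mem_univ _, ?_⟩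
    simpa using (Finset.mem_filter.mp hi).2

theorem rankAt_mem_Icc {m : ℕ} (h : Fin m → ℝ) (σ : Equiv.Perm (Fin m)) (j : Fin m) :
    rankAt h σ j ∈ Finset.Icc 1 m := by
  classical
  rw [Finset.mem_Icc]
  constructor
  · exact Finset.card_pos.mpr ⟨j, by simp⟩
  · exact (Finset.card_le_univ _).trans (by simp)

theorem rankAt_lt {m : ℕ} (h : Fin m → ℝ) (σ : Equiv.Perm (Fin m)) {i j : Fin m}
    (hij : h i < h j ∨ (h i = h j ∧ σ i < σ j)) : rankAt h σ i < rankAt h σ j := by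
  classical
  apply Finset.card_lt_card
  rw [Finset.ssubset_iff_of_subset]
  · refine ⟨j, by simp, ?_⟩
    simp only [Finset.mem_filter, Finset.mem_univ, true_and]
    rintro (h1 | ⟨h1, h2⟩) <;> rcases hij with h3 | ⟨h3, h4⟩
    · exact lt_asymm h1 h3
    · exact h1.ne' h3
    · exact h3.ne' h1
    · exact absurd h2 (not_le.mpr h4)
  · intro l
    simp only [Finset.mem_filter, Finset.mem_univ, true_and]
    rintro (h1 | ⟨h1, h2⟩) <;> rcases hij with h3 | ⟨h3, h4⟩
    · exact Or.inl (h1.trans h3)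
    · exact Or.inl (h3 ▸ h1)
    · exact Or.inl (h1 ▸ h3)
    · exact Or.inr ⟨h1.trans h3, h2.trans h4.le⟩

theorem rankAt_injective {m : ℕ} (h : Fin m → ℝ) (σ : Equiv.Perm (Fin m)) :
    Function.Injective (rankAt h σ) := by
  intro i j hij
  by_contra hne
  have hσ : σ i ≠ σ j := fun e => hne (σ.injective e)
  rcases lt_trichotomy (h i) (h j) with h1 | h1 | h1
  · exact (rankAt_lt h σ (Or.inl h1)).ne hij
  · rcases hσ.lt_or_gt with h2 | h2
    · exact (rankAt_lt h σ (Or.inr ⟨h1, h2⟩)).ne hij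
    · exact (rankAt_lt h σ (Or.inr ⟨h1.symm, h2⟩)).ne' hij
  · exact (rankAt_lt h σ (Or.inl h1)).ne' hij

/-- Ties are resolved by `σ`, so the rank is the position in a strict linear order: an injection
into a set of the same size, hence a bijection. -/
theorem card_filter_rankAt_eq {m : ℕ} (h : Fin m → ℝ) (σ : Equiv.Perm (Fin m)) {k : ℕ}
    (hk : k ∈ Finset.Icc 1 m) : (Finset.univ.filter fun j => rankAt h σ j = k).card = 1 := by
  have himg : Finset.univ.image (rankAt h σ) = Finset.Icc 1 m := by
    apply Finset.eq_of_subset_of_card_le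
    · intro l hl
      obtain ⟨j, -, rfl⟩ := Finset.mem_image.mp hl
      exact rankAt_mem_Icc h σ j
    · rw [Finset.card_image_of_injective _ (rankAt_injective h σ)]
      simp
  rw [← himg] at hk
  obtain ⟨j, -, hj⟩ := Finset.mem_image.mp hk
  rw [Finset.card_eq_one]
  refine ⟨j, Finset.ext fun i => ?_⟩
  simp only [Finset.mem_filter, Finset.mem_univ, true_and, Finset.mem_singleton]
  exact ⟨fun e => rankAt_injective h σ (e.trans hj.symm), fun e => e ▸ hj⟩

/-- Among all vectors `φ ∘ g` and all tie breaking orders, every rank of the first coordinate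
occurs equally often. -/
theorem card_rankFirst_comp {G : Type*} [Fintype G] {B : ℕ} (φ : G → ℝ) {k : ℕ}
    (hk : k ∈ Finset.Icc 1 (B + 1)) :
    (B + 1) * (Finset.univ.filter fun q : (Fin (B + 1) → G) × Equiv.Perm (Fin (B + 1)) =>
      rankFirst (φ ∘ q.1) q.2 = k).card =
      Fintype.card ((Fin (B + 1) → G) × Equiv.Perm (Fin (B + 1))) := by
  have hj : ∀ j : Fin (B + 1),
      (Finset.univ.filter fun q : (Fin (B + 1) → G) × Equiv.Perm (Fin (B + 1)) =>
        rankAt (φ ∘ q.1) q.2 j = k).card =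
      (Finset.univ.filter fun q : (Fin (B + 1) → G) × Equiv.Perm (Fin (B + 1)) =>
        rankFirst (φ ∘ q.1) q.2 = k).card := by
    intro j
    -- Swapping coordinates `0` and `j` in both the tuple and the tie-breaking order is a bijection
    -- that turns the rank of `j` into the rank of `0`.
    refine Finset.card_bij
      (fun q _ => (q.1 ∘ Equiv.swap 0 j, (Equiv.swap 0 j).trans q.2)) ?_ ?_ ?_
    · intro q hq
      simp only [Finset.mem_filter, Finset.mem_univ, true_and] at hq ⊢
      rw [rankFirst_eq_rankAt, ← Function.comp_assoc, rankAt_comp, Equiv.swap_apply_left, hq]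
    · rintro ⟨g, s⟩ _ ⟨g', s'⟩ _ h
      simp only [Prod.mk.injEq] at h
      refine Prod.ext ?_ ?_
      · funext i
        have := congrFun h.1 (Equiv.swap 0 j i)
        simpa using this
      · ext i
        have := congrArg (fun e => e (Equiv.swap 0 j i)) h.2
        simpa using congrArg Fin.val this
    · rintro ⟨g, s⟩ hq
      refine ⟨(g ∘ Equiv.swap 0 j, (Equiv.swap 0 j).trans s), ?_, ?_⟩
      · simp only [Finset.mem_filter, Finset.mem_univ, true_and] at hq ⊢
        rw [← Function.comp_assoc, rankAt_comp, Equiv.swap_apply_right, ← rankFirst_eq_rankAt, hq]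
      · refine Prod.ext ?_ ?_
        · funext i
          simp
        · ext i
          simp
  calc (B + 1) * _ = ∑ j : Fin (B + 1),
        (Finset.univ.filter fun q : (Fin (B + 1) → G) × Equiv.Perm (Fin (B + 1)) =>
          rankAt (φ ∘ q.1) q.2 j = k).card := by
        simp [hj]
    _ = ∑ q : (Fin (B + 1) → G) × Equiv.Perm (Fin (B + 1)),
        (Finset.univ.filter fun j => rankAt (φ ∘ q.1) q.2 j = k).card := by
        simp only [Finset.card_filter]
        exact Finset.sum_comm
    _ = _ := by
        simp [card_filter_rankAt_eq _ _ hk]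

/-- A multiset forgets the indexing, so the pairs can be relisted along `g`. This puts all
randomness of the test into the times, with `x` fixed. -/
theorem dataset_comp_perm {n d : ℕ} (x : Fin n → Cov d) (t : Fin n → ℝ≥0)
    (g : Equiv.Perm (Fin n)) : dataset (x ∘ g) t = dataset x (t ∘ g.symm) := by
  unfold dataset
  have h := congrArg Finset.val (Finset.map_univ_equiv g)
  rw [Finset.map_val] at h
  conv_rhs => rw [← h, Multiset.map_map]
  simp

/-- Summed over all rearrangements of the times, every rank of the first coordinate of the test
vector occurs equally often. -/
theorem card_rankFirst_testVector {n d B : ℕ} (H : Multiset (Cov d × ℝ≥0) → ℝ)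
    (x : Fin n → Cov d) (t : Fin n → ℝ≥0) {k : ℕ} (hk : k ∈ Finset.Icc 1 (B + 1)) :
    (B + 1) * ∑ h : Equiv.Perm (Fin n),
      (Finset.univ.filter fun q : (Fin B → Equiv.Perm (Fin n)) × Equiv.Perm (Fin (B + 1)) =>
        rankFirst (testVector H x (t ∘ h) q.1) q.2 = k).card =
      Fintype.card (Equiv.Perm (Fin n)) *
        Fintype.card ((Fin B → Equiv.Perm (Fin n)) × Equiv.Perm (Fin (B + 1))) := by
  let φ : Equiv.Perm (Fin n) → ℝ := fun g => H (dataset x (t ∘ g))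
  have htv : ∀ (h : Equiv.Perm (Fin n)) (p : Fin B → Equiv.Perm (Fin n)),
      testVector H x (t ∘ h) p = φ ∘ (Fin.cons h fun b => h * (p b)⁻¹) := by
    intro h p
    funext j
    refine Fin.cases ?_ (fun b => ?_) j
    · rfl
    · simp only [testVector, Fin.cons_succ, Function.comp_apply, φ, dataset_comp_perm]
      rfl
  -- A change of variables to arbitrary `(B + 1)`-tuples of permutations; the first entry recovers
  -- `h`, and then each `p b` is determined.
  let e : Equiv.Perm (Fin n) × (Fin B → Equiv.Perm (Fin n)) ≃
      (Fin (B + 1) → Equiv.Perm (Fin n)) :=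
    { toFun := fun q => Fin.cons q.1 fun b => q.1 * (q.2 b)⁻¹
      invFun := fun g => (g 0, fun b => (g b.succ)⁻¹ * g 0)
      left_inv := fun q => by simp
      right_inv := fun g => by
        funext j
        refine Fin.cases ?_ (fun b => ?_) j <;> simp }
  have hcard := card_rankFirst_comp (B := B) φ hk
  have h1 : ∑ h : Equiv.Perm (Fin n),
      (Finset.univ.filter fun q : (Fin B → Equiv.Perm (Fin n)) × Equiv.Perm (Fin (B + 1)) =>
        rankFirst (testVector H x (t ∘ h) q.1) q.2 = k).card =
      (Finset.univ.filter fun q : (Fin (B + 1) → Equiv.Perm (Fin n)) × Equiv.Perm (Fin (B + 1)) =>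
        rankFirst (φ ∘ q.1) q.2 = k).card := by
    simp only [Finset.card_filter, htv, Fintype.sum_prod_type]
    rw [← e.sum_comp, Fintype.sum_prod_type]
    rfl
  rw [h1, hcard, Fintype.card_prod, Fintype.card_prod, ← mul_assoc, ← Fintype.card_congr e,
    Fintype.card_prod]

theorem card_filter_le_Icc (B : ℕ) {α : ℝ} (hα₀ : 0 ≤ α) (hα₁ : α ≤ 1) :
    (((Finset.Icc 1 (B + 1)).filter fun k : ℕ =>
      (1 - α) * ((B : ℝ) + 1) + 1 ≤ (k : ℝ)).card : ℝ) = (⌊α * ((B : ℝ) + 1)⌋ : ℝ) := by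
  have hB : (0 : ℝ) ≤ α * ((B : ℝ) + 1) := by positivity
  obtain ⟨m, hm⟩ : ∃ m : ℕ, ⌊α * ((B : ℝ) + 1)⌋ = m := Int.eq_ofNat_of_zero_le (Int.floor_nonneg.mpr hB)
  have hm' := Int.floor_eq_iff.mp hm
  push_cast at hm'
  have hmB : m ≤ B + 1 := by
    have : (m : ℝ) ≤ ((B + 1 : ℕ) : ℝ) := by
      push_cast
      nlinarith [hm'.1]
    exact_mod_cast this
  -- The threshold equals `B + 2 - α (B + 1)`, so an integer `k` reaches it iff `B + 2 - k ≤ m`,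
  -- where `m` is the floor.
  have : (Finset.Icc 1 (B + 1)).filter (fun k : ℕ =>
      (1 - α) * ((B : ℝ) + 1) + 1 ≤ (k : ℝ)) = Finset.Icc (B + 2 - m) (B + 1) := by
    ext k
    simp only [Finset.mem_filter, Finset.mem_Icc]
    constructor
    · rintro ⟨⟨h1, h2⟩, h3⟩
      refine ⟨?_, h2⟩
      have : ((B + 2 : ℕ) : ℝ) < ((k + m + 1 : ℕ) : ℝ) := by
        push_cast
        linarith [hm'.2]
      have : B + 2 < k + m + 1 := by exact_mod_cast this
      omega
    · rintro ⟨h1, h2⟩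
      refine ⟨⟨by omega, h2⟩, ?_⟩
      have : ((B + 2 : ℕ) : ℝ) ≤ ((k + m : ℕ) : ℝ) := by
        exact_mod_cast (by omega : B + 2 ≤ k + m)
      push_cast at this
      linarith [hm'.1]
  rw [this, hm, Nat.card_Icc]
  have : B + 1 + 1 - (B + 2 - m) = m := by omega
  rw [this]
  simp

end Rank

/-! ### Exchangeability of the assigned times under rearrangement of the data -/

section Exchangeability

variable {n d : ℕ} {τ : Type*}

theorem IsUniformCoupling.sum_left {A L : Finset (Fin n)} {hA : A.Nonempty} {hL : L.Nonempty}
    {Q : PMF (Fin n × Fin n)} (h : IsUniformCoupling A L hA hL Q) (i : Fin n) :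
    ∑ j, Q (i, j) = if i ∈ A then (A.card : ℝ≥0∞)⁻¹ else 0 := by
  classical
  refine Eq.trans (b := PMF.uniformOfFinset A hA i) ?_
    (by rw [PMF.uniformOfFinset_apply]; congr)
  rw [← h.1, PMF.map_apply, tsum_fintype, Fintype.sum_prod_type]
  symm
  rw [Finset.sum_eq_single i]
  · simp
  · intro b _ hb
    simp [hb.symm]
  · simp

theorem IsUniformCoupling.sum_right {A L : Finset (Fin n)} {hA : A.Nonempty} {hL : L.Nonempty}
    {Q : PMF (Fin n × Fin n)} (h : IsUniformCoupling A L hA hL Q) (j : Fin n) :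
    ∑ i, Q (i, j) = if j ∈ L then (L.card : ℝ≥0∞)⁻¹ else 0 := by
  classical
  refine Eq.trans (b := PMF.uniformOfFinset L hL j) ?_
    (by rw [PMF.uniformOfFinset_apply]; congr)
  rw [← h.2, PMF.map_apply, tsum_fintype,
    Fintype.sum_prod_type_right]
  symm
  rw [Finset.sum_eq_single j]
  · simp
  · intro b _ hb
    simp [hb.symm]
  · simp

/-- If the first pick of a coupling is drawn uniformly, then the second pick is uniform. -/
theorem IsUniformCoupling.sum_condPick {A L : Finset (Fin n)} {hA : A.Nonempty} {hL : L.Nonempty}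
    {Q : PMF (Fin n × Fin n)} (h : IsUniformCoupling A L hA hL Q) (j : Fin n) :
    ∑ i ∈ A, condPick Q i j = if j ∈ L then (A.card : ℝ≥0∞) * (L.card : ℝ≥0∞)⁻¹ else 0 := by
  classical
  have h0 : (A.card : ℝ≥0∞) ≠ 0 := by simpa using hA.ne_empty
  have h1 : ∀ i ∈ A, condPick Q i j = A.card * Q (i, j) := by
    intro i hi
    have hs : ∑' j, Q (i, j) = (A.card : ℝ≥0∞)⁻¹ := by
      rw [tsum_fintype, h.sum_left, if_pos hi]
    have hne : ∑' j, Q (i, j) ≠ 0 := by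
      rw [hs]
      simp
    rw [condPick, dif_neg hne, PMF.normalize_apply, hs, inv_inv, mul_comm]
  rw [Finset.sum_congr rfl h1, ← Finset.mul_sum]
  -- Rows outside `A` have zero marginal mass, so the sum over `A` is already the full second
  -- marginal.
  have h2 : ∑ i ∈ A, Q (i, j) = ∑ i, Q (i, j) := by
    refine Finset.sum_subset (Finset.subset_univ A) fun i _ hi => ?_
    have := h.sum_left i
    rw [if_neg hi, Finset.sum_eq_zero_iff] at this
    exact this j (Finset.mem_univ j)
  rw [h2, h.sum_right, mul_ite, mul_zero]

/-- The expectation of `f` of the times which the main loop assigns, when each individual comes with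
its event indicator and its time. -/
noncomputable def labelLoop (Q : Finset (Fin n) → Finset (Fin n) → PMF (Fin n × Fin n))
    (f : (Fin n → τ) → ℝ≥0∞) :
    List (Fin n × Bool × τ) → Finset (Fin n) → Finset (Fin n) → (Fin n → τ) → ℝ≥0∞
  | [], _, _, t => f t
  | (i, b, z) :: l, A, L, t =>
    if b = true then
      ∑ j, condPick (Q A L) i j * labelLoop Q f l (A.erase i) (L.erase j) (Function.update t j z)
    else labelLoop Q f l (A.erase i) L t

/-- The expectation of `f` of the assigned times, when at each event an index is drawn uniformly
from the indices that have not been drawn before. -/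
noncomputable def uniformLoop (f : (Fin n → τ) → ℝ≥0∞) :
    List (Bool × τ) → Finset (Fin n) → (Fin n → τ) → ℝ≥0∞
  | [], _, t => f t
  | (b, z) :: l, L, t =>
    if b = true then
      ∑ j ∈ L, (L.card : ℝ≥0∞)⁻¹ * uniformLoop f l (L.erase j) (Function.update t j z)
    else uniformLoop f l L t

/-- Recording times instead of individuals separates the two roles of an individual: its identity
enters only through the coupling, its label `(δ i, z i)` through the result. -/
theorem sum_transformLoop_mul (Q : Finset (Fin n) → Finset (Fin n) → PMF (Fin n × Fin n))
    (δ : Fin n → Bool) (z : Fin n → τ) (f : (Fin n → τ) → ℝ≥0∞) (l : List (Fin n))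
    (A L : Finset (Fin n)) (a : Fin n → Fin n) :
    ∑ a₀, transformLoop Q δ l A L a a₀ * f (z ∘ a₀) =
      labelLoop Q f (l.map fun i => (i, δ i, z i)) A L (z ∘ a) := by
  classical
  induction l generalizing A L a with
  | nil => simp [transformLoop, labelLoop, PMF.pure_apply]
  | cons i l ih =>
    rw [transformLoop, List.map_cons, labelLoop]
    split_ifs with hδ
    · simp only [PMF.bind_apply, tsum_fintype, Finset.sum_mul]
      rw [Finset.sum_comm]
      refine Finset.sum_congr rfl fun j _ => ?_
      simp only [mul_assoc]
      rw [← Finset.mul_sum, ih, Function.comp_update]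
    · exact ih _ _ _

/-- Orders of processing are encoded as injective sequences in `A`, so that removing the first
individual leaves a sum of the same form over `A.erase i`. -/
theorem sum_injective_cons {m : ℕ} (A : Finset (Fin n)) (F : (Fin (m + 1) → Fin n) → ℝ≥0∞) :
    (∑ e : Fin (m + 1) → Fin n,
      open Classical in if Function.Injective e ∧ ∀ k, e k ∈ A then F e else 0) =
      ∑ i ∈ A, ∑ e : Fin m → Fin n,
        open Classical in if Function.Injective e ∧ ∀ k, e k ∈ A.erase i then F (Fin.cons i e)
          else 0 := by
  classical
  rw [← (Fin.consEquiv fun _ : Fin (m + 1) => Fin n).sum_comp, Fintype.sum_prod_type,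
    ← Finset.sum_subset (Finset.subset_univ A)]
  · refine Finset.sum_congr rfl fun i hi => Finset.sum_congr rfl fun e _ => ?_
    refine if_congr ?_ rfl rfl
    change Function.Injective (Fin.cons i e : Fin (m + 1) → Fin n) ∧
      (∀ k, (Fin.cons i e : Fin (m + 1) → Fin n) k ∈ A) ↔ _
    simp only [Fin.cons_injective_iff, Fin.forall_fin_succ, Fin.cons_zero,
      Fin.cons_succ, hi, true_and, Finset.mem_erase, Set.mem_range, not_exists]
    constructor
    · rintro ⟨⟨h1, h2⟩, h3⟩
      exact ⟨h2, fun k => ⟨h1 k, h3 k⟩⟩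
    · rintro ⟨h2, h3⟩
      exact ⟨⟨fun k => (h3 k).1, h2⟩, fun k => (h3 k).2⟩
  · intro i _ hi
    refine Finset.sum_eq_zero fun e _ => if_neg ?_
    rintro ⟨-, h⟩
    exact hi (by simpa using h 0)

/-- If the individuals are processed in a uniformly random order, then the main loop draws
uniformly without replacement. -/
theorem sum_labelLoop (Q : Finset (Fin n) → Finset (Fin n) → PMF (Fin n × Fin n))
    (hQ : ∀ A L (hA : A.Nonempty) (hL : L.Nonempty), IsUniformCoupling A L hA hL (Q A L))
    (f : (Fin n → τ) → ℝ≥0∞) {m : ℕ} (w : Fin m → Bool × τ) (A L : Finset (Fin n))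
    (hA : A.card = m) (hL : m ≤ L.card) (t : Fin n → τ) :
    (∑ e : Fin m → Fin n,
      open Classical in if Function.Injective e ∧ ∀ k, e k ∈ A then
        labelLoop Q f (List.ofFn fun k => (e k, w k)) A L t else 0) =
      (m.factorial : ℝ≥0∞) * uniformLoop f (List.ofFn w) L t := by
  classical
  induction m generalizing A L t with
  | zero =>
    rw [Fintype.sum_unique, if_pos ⟨Function.injective_of_subsingleton _, fun k => k.elim0⟩]
    simp [labelLoop, uniformLoop]
  | succ m ih =>
    rw [sum_injective_cons]
    simp only [List.ofFn_succ, Fin.cons_zero, Fin.cons_succ]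
    rcases w 0 with ⟨b, z⟩
    have hAne : A.Nonempty := Finset.card_pos.mp (by omega)
    have hLne : L.Nonempty := Finset.card_pos.mp (by omega)
    simp only [labelLoop, uniformLoop]
    have hcard : ∀ i ∈ A, (A.erase i).card = m := fun i hi => by
      rw [Finset.card_erase_of_mem hi, hA]
      rfl
    split_ifs with hb
    -- The key step: after averaging over the order of the others, the future no longer sees
    -- `A.erase i`. Hence `i` remains only in the factor `condPick (Q A L) i j`, which can then be
    -- summed over `A`.
    · have h1 : ∀ i ∈ A, (∑ e : Fin m → Fin n,
          if Function.Injective e ∧ ∀ k, e k ∈ A.erase i then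
            ∑ j, condPick (Q A L) i j * labelLoop Q f (List.ofFn fun k => (e k, w k.succ))
              (A.erase i) (L.erase j) (Function.update t j z) else 0) =
          ∑ j, condPick (Q A L) i j * ((m.factorial : ℝ≥0∞) *
            uniformLoop f (List.ofFn fun k => w k.succ) (L.erase j) (Function.update t j z)) := by
        intro i hi
        have h2 : ∀ j, (m.factorial : ℝ≥0∞) *
            uniformLoop f (List.ofFn fun k => w k.succ) (L.erase j) (Function.update t j z) =
            ∑ e : Fin m → Fin n, if Function.Injective e ∧ ∀ k, e k ∈ A.erase i then
              labelLoop Q f (List.ofFn fun k => (e k, w k.succ)) (A.erase i) (L.erase j)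
                (Function.update t j z) else 0 := fun j =>
          (ih (fun k => w k.succ) _ _ (hcard i hi)
            -- The sum over `j` also contains indices outside `L`; erasing lowers the cardinality by
            -- at most one in either case.
            (by have := Finset.pred_card_le_card_erase (s := L) (a := j); omega) _).symm
        simp only [h2, Finset.mul_sum]
        rw [Finset.sum_comm]
        refine Finset.sum_congr rfl fun e _ => ?_
        split_ifs with he <;> simp
      rw [Finset.sum_congr rfl h1, Finset.sum_comm]
      simp only [← Finset.sum_mul, (hQ A L hAne hLne).sum_condPick]
      rw [Finset.mul_sum, ← Finset.sum_subset (Finset.subset_univ L)]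
      · refine Finset.sum_congr rfl fun j hj => ?_
        -- The factor `A.card = m + 1` from `sum_condPick` turns `m !` into `(m + 1)!`.
        rw [if_pos hj, hA, Nat.factorial_succ]
        push_cast
        ring
      · intro j _ hj
        rw [if_neg hj, zero_mul]
    · rw [Finset.sum_congr rfl fun i hi => ih (fun k => w k.succ) _ L (hcard i hi) (by omega) t,
        Finset.sum_const, hA, Nat.factorial_succ]
      simp [mul_assoc]

/-- Uniform draws favour no index, so relabelling the result can be moved to the initial set and the
initial times. -/
theorem uniformLoop_comp (f : (Fin n → τ) → ℝ≥0∞) (h : Equiv.Perm (Fin n))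
    (w : List (Bool × τ)) (L : Finset (Fin n)) (t : Fin n → τ) :
    uniformLoop (fun s => f (s ∘ h)) w L t =
      uniformLoop f w (L.map h.symm.toEmbedding) (t ∘ h) := by
  classical
  induction w generalizing L t with
  | nil => rfl
  | cons p w ih =>
    obtain ⟨b, z⟩ := p
    simp only [uniformLoop, ih, Finset.sum_map, Finset.card_map]
    refine if_congr Iff.rfl (Finset.sum_congr rfl fun j _ => ?_) rfl
    rw [Finset.map_erase]
    congr 2
    funext i
    simp only [Function.comp_apply, Function.update_apply, Equiv.coe_toEmbedding,
      Equiv.eq_symm_apply]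

theorem sum_perm_labelLoop (Q : Finset (Fin n) → Finset (Fin n) → PMF (Fin n × Fin n))
    (hQ : ∀ A L (hA : A.Nonempty) (hL : L.Nonempty), IsUniformCoupling A L hA hL (Q A L))
    (f : (Fin n → τ) → ℝ≥0∞) (w : Fin n → Bool × τ) (t : Fin n → τ) :
    ∑ e : Equiv.Perm (Fin n), labelLoop Q f (List.ofFn fun k => (e k, w k))
      Finset.univ Finset.univ t =
      (n.factorial : ℝ≥0∞) * uniformLoop f (List.ofFn w) Finset.univ t := by
  classical
  rw [← sum_labelLoop Q hQ f w Finset.univ Finset.univ (by simp) (by simp) t,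
    ← Finset.sum_filter]
  refine Finset.sum_bij (fun e _ => ⇑e) ?_ ?_ ?_ ?_
  · intro e _
    simpa using e.injective
  · intro e _ e' _ h
    exact DFunLike.coe_injective h
  · intro e he
    simp only [Finset.mem_filter, Finset.mem_univ, implies_true, and_true, true_and] at he
    exact ⟨Equiv.ofBijective e (Finite.injective_iff_bijective.mp he), Finset.mem_univ _, rfl⟩
  · intro e _
    rfl

/-- The permutation that sorts the individuals by time, where ties are broken by `ρ`. -/
noncomputable def timeSort (z : Fin n → ℝ≥0) (ρ : Equiv.Perm (Fin n)) : Equiv.Perm (Fin n) :=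
  Tuple.sort fun i => toLex (z i, ρ i)

/-- The keys are distinct because `ρ` is injective, so the stability clause in `Tuple.eq_sort_iff`
is vacuous and monotonicity determines the sorting permutation. -/
theorem eq_timeSort_iff (z : Fin n → ℝ≥0) (ρ s : Equiv.Perm (Fin n)) :
    s = timeSort z ρ ↔ Monotone fun k => toLex (z (s k), ρ (s k)) := by
  unfold timeSort
  rw [Tuple.eq_sort_iff]
  refine and_iff_left_of_imp fun _ i j hij h => ?_
  have h2 : ρ (s i) = ρ (s j) := congrArg (fun p => (ofLex p).2) h
  exact absurd (s.injective (ρ.injective h2)) hij.ne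

/-- When the tie breaker moves along with the data, the sorted sequence of keys is unchanged; only
the names of the individuals change. -/
theorem timeSort_comp (z : Fin n → ℝ≥0) (g ρ : Equiv.Perm (Fin n)) :
    timeSort (z ∘ g) (g.trans ρ) = (timeSort z ρ).trans g.symm := by
  symm
  rw [eq_timeSort_iff]
  simpa using (eq_timeSort_iff z ρ _).mp rfl

theorem getLastD_ofFn (s : Fin n → Fin n) (j : Fin n) :
    (List.ofFn s).getLastD j = s ⟨n - 1, by have := j.2; omega⟩ := by
  have := j.2
  rw [List.getLastD_eq_getLast?, List.getLast?_eq_getElem?, List.length_ofFn,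
    List.getElem?_ofFn, dif_pos (by omega)]
  rfl

theorem transformLaw_apply
    (plan : (Fin n → Cov d) → Finset (Fin n) → Finset (Fin n) → PMF (Fin n × Fin n))
    (x : Fin n → Cov d) (z : Fin n → ℝ≥0) (δ : Fin n → Bool) (a₀ : Fin n → Fin n) :
    transformLaw plan x z δ a₀ = ∑ ρ, (Fintype.card (Equiv.Perm (Fin n)) : ℝ≥0∞)⁻¹ *
      transformLoop (plan x) δ (timeOrder z ρ) Finset.univ Finset.univ
        (fun j => (timeOrder z ρ).getLastD j) a₀ := by
  rw [transformLaw, PMF.bind_apply, tsum_fintype]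
  simp

/-- The times assigned by the transformation in uniformly rearranged data, in terms of uniform draws
without replacement. -/
theorem sum_perm_transformLaw
    {plan : (Fin n → Cov d) → Finset (Fin n) → Finset (Fin n) → PMF (Fin n × Fin n)}
    (hplan : IsOptimalPlan plan)
    (x : Fin n → Cov d) (z : Fin n → ℝ≥0) (δ : Fin n → Bool) (f : (Fin n → ℝ≥0) → ℝ≥0∞) :
    ∑ g : Equiv.Perm (Fin n), ∑ a₀, transformLaw plan x (z ∘ g) (δ ∘ g) a₀ * f ((z ∘ g) ∘ a₀) =
      ∑ ρ : Equiv.Perm (Fin n), (Fintype.card (Equiv.Perm (Fin n)) : ℝ≥0∞)⁻¹ *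
        ((n.factorial : ℝ≥0∞) * uniformLoop f
          (List.ofFn fun k => (δ (timeSort z ρ k), z (timeSort z ρ k))) Finset.univ
          fun j => z (timeSort z ρ ⟨n - 1, by have := j.2; omega⟩)) := by
  classical
  simp only [transformLaw_apply, Finset.sum_mul, mul_assoc]
  have h1 : ∀ g : Equiv.Perm (Fin n),
      ∑ a₀, ∑ ρ, (Fintype.card (Equiv.Perm (Fin n)) : ℝ≥0∞)⁻¹ *
        (transformLoop (plan x) (δ ∘ g) (timeOrder (z ∘ g) ρ) Finset.univ Finset.univ
          (fun j => (timeOrder (z ∘ g) ρ).getLastD j) a₀ * f ((z ∘ g) ∘ a₀)) =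
      ∑ ρ, (Fintype.card (Equiv.Perm (Fin n)) : ℝ≥0∞)⁻¹ * labelLoop (plan x) f
        (List.ofFn fun k => (((timeSort z ρ).trans g.symm) k,
          (δ (timeSort z ρ k), z (timeSort z ρ k)))) Finset.univ Finset.univ
          fun j => z (timeSort z ρ ⟨n - 1, by have := j.2; omega⟩) := by
    intro g
    -- The tie breaker is summed over all permutations, so it may be replaced by `ρ * g`, which is
    -- the form that `timeSort_comp` needs.
    rw [Finset.sum_comm, ← Equiv.sum_comp (Equiv.mulRight g)]
    refine Finset.sum_congr rfl fun ρ _ => ?_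
    rw [← Finset.mul_sum, sum_transformLoop_mul]
    have h2 : timeOrder (z ∘ g) (Equiv.mulRight g ρ) =
        List.ofFn ((timeSort z ρ).trans g.symm) := by
      rw [← timeSort_comp]
      rfl
    rw [h2, List.map_ofFn]
    congr 2
    · congr 1
      funext k
      simp
    · funext j
      simp only [Function.comp_apply, getLastD_ofFn, Equiv.trans_apply, Equiv.apply_symm_apply]
  rw [Finset.sum_congr rfl fun g _ => h1 g, Finset.sum_comm]
  refine Finset.sum_congr rfl fun ρ _ => ?_
  rw [← Finset.mul_sum, ← sum_perm_labelLoop (plan x)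
    (fun A L hA hL => (hplan.optimal x A L hA hL).1)]
  congr 1
  -- For fixed `ρ`, the order of the individuals `g⁻¹ * timeSort z ρ` runs through every permutation
  -- once.
  exact Fintype.sum_equiv ((Equiv.inv _).trans (Equiv.mulRight (timeSort z ρ))) _ _ fun g => rfl

/-- The times assigned by the transformation in uniformly rearranged data are exchangeable. -/
theorem sum_perm_transformLaw_comp
    {plan : (Fin n → Cov d) → Finset (Fin n) → Finset (Fin n) → PMF (Fin n × Fin n)}
    (hplan : IsOptimalPlan plan)
    (x : Fin n → Cov d) (z : Fin n → ℝ≥0) (δ : Fin n → Bool) (f : (Fin n → ℝ≥0) → ℝ≥0∞)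
    (h : Equiv.Perm (Fin n)) :
    ∑ g : Equiv.Perm (Fin n), ∑ a₀,
        transformLaw plan x (z ∘ g) (δ ∘ g) a₀ * f (((z ∘ g) ∘ a₀) ∘ h) =
      ∑ g : Equiv.Perm (Fin n), ∑ a₀,
        transformLaw plan x (z ∘ g) (δ ∘ g) a₀ * f ((z ∘ g) ∘ a₀) := by
  rw [sum_perm_transformLaw hplan, sum_perm_transformLaw hplan x z δ fun s => f (s ∘ h)]
  refine Finset.sum_congr rfl fun ρ _ => ?_
  -- The initial times are all equal to the last observed time, so composing them with `h` changes
  -- nothing.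
  rw [uniformLoop_comp, Finset.map_univ_equiv]
  rfl

end Exchangeability

/-! ### Measurability of the transformation -/

section Measurability

variable {n d : ℕ}

instance instDiscreteMeasurableSpacePermFin (n : ℕ) :
    DiscreteMeasurableSpace (Equiv.Perm (Fin n)) := ⟨fun _ => MeasurableSpace.measurableSet_top⟩

theorem measurable_timeSort (ρ : Equiv.Perm (Fin n)) :
    Measurable fun z : Fin n → ℝ≥0 => timeSort z ρ := by
  refine measurable_to_countable' fun s => ?_
  have : (fun z : Fin n → ℝ≥0 => timeSort z ρ) ⁻¹' {s} = ⋂ i, ⋂ j, ⋂ _ : i ≤ j,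
      ({z : Fin n → ℝ≥0 | z (s i) < z (s j)} ∪
        {z : Fin n → ℝ≥0 | z (s i) = z (s j)} ∩ {_z | ρ (s i) ≤ ρ (s j)}) := by
    ext z
    rw [Set.mem_preimage, Set.mem_singleton_iff, eq_comm, eq_timeSort_iff]
    simp only [Set.mem_iInter, Set.mem_union, Set.mem_inter_iff, Set.mem_ofPred_eq, Monotone,
      Prod.Lex.toLex_le_toLex]
  rw [this]
  refine MeasurableSet.iInter fun i => MeasurableSet.iInter fun j => MeasurableSet.iInter fun _ => ?_
  exact (measurableSet_lt (by fun_prop) (by fun_prop)).union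
    ((measurableSet_eq_fun (by fun_prop) (by fun_prop)).inter (MeasurableSet.const _))

theorem measurable_condPick {β : Type*} [MeasurableSpace β] {Q : β → PMF (Fin n × Fin n)}
    (hQ : ∀ p, Measurable fun b => Q b p) (i j : Fin n) :
    Measurable fun b => condPick (Q b) i j := by
  classical
  have hs : Measurable fun b => ∑ j, Q b (i, j) := Finset.measurable_sum _ fun j _ => hQ _
  have : (fun b => condPick (Q b) i j) = fun b =>
      if ∑ j, Q b (i, j) = 0 then PMF.pure i j else Q b (i, j) * (∑ j, Q b (i, j))⁻¹ := by
    funext b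
    unfold condPick
    simp only [tsum_fintype]
    split_ifs with h
    · rfl
    · rw [PMF.normalize_apply, tsum_fintype]
  rw [this]
  exact Measurable.ite (hs (measurableSet_singleton 0)) measurable_const ((hQ _).mul hs.inv)

theorem measurable_transformLoop {β : Type*} [MeasurableSpace β]
    {Q : β → Finset (Fin n) → Finset (Fin n) → PMF (Fin n × Fin n)}
    (hQ : ∀ A L p, Measurable fun b => Q b A L p) (δ : Fin n → Bool) (l : List (Fin n))
    (A L : Finset (Fin n)) (a a₀ : Fin n → Fin n) :
    Measurable fun b => transformLoop (Q b) δ l A L a a₀ := by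
  induction l generalizing A L a with
  | nil => exact measurable_const
  | cons i l ih =>
    by_cases hδ : δ i = true
    · simp only [transformLoop, if_pos hδ, PMF.bind_apply, tsum_fintype]
      exact Finset.measurable_sum _ fun j _ => (measurable_condPick (hQ A L) i j).mul (ih _ _ _)
    · simp only [transformLoop, if_neg hδ]
      exact ih _ _ _

theorem measurable_transformLaw
    {plan : (Fin n → Cov d) → Finset (Fin n) → Finset (Fin n) → PMF (Fin n × Fin n)}
    (hplan : IsOptimalPlan plan) {β : Type*} [MeasurableSpace β] {x : β → Fin n → Cov d}
    {z : β → Fin n → ℝ≥0} {δ : β → Fin n → Bool} (hx : Measurable x) (hz : Measurable z)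
    (hδ : Measurable δ) (a₀ : Fin n → Fin n) :
    Measurable fun b => transformLaw plan (x b) (z b) (δ b) a₀ := by
  simp only [transformLaw_apply]
  refine Finset.measurable_sum _ fun ρ _ => Measurable.const_mul ?_ _
  -- The times act only through the indicators and the sorting permutation, which take finitely many
  -- values; with these fixed, only measurability in `x` remains.
  have hG : Measurable fun q : (Fin n → Cov d) × ((Fin n → Bool) × Equiv.Perm (Fin n)) =>
      transformLoop (plan q.1) q.2.1 (List.ofFn q.2.2) Finset.univ Finset.univ
        (fun j => (List.ofFn q.2.2).getLastD j) a₀ :=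
    measurable_from_prod_countable_left fun q =>
      measurable_transformLoop (Q := plan) hplan.measurable q.1 (List.ofFn q.2) Finset.univ
        Finset.univ (fun j => (List.ofFn q.2).getLastD j) a₀
  exact hG.comp (hx.prodMk (hδ.prodMk ((measurable_timeSort ρ).comp hz)))

theorem measurable_obsTime :
    Measurable fun q : (Fin n → ℝ≥0) × (Fin n → ℝ≥0) => obsTime q.1 q.2 := by
  unfold obsTime
  fun_prop

theorem measurable_obsEvent :
    Measurable fun q : (Fin n → ℝ≥0) × (Fin n → ℝ≥0) => obsEvent q.1 q.2 := by
  refine measurable_pi_lambda _ fun i => measurable_to_bool ?_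
  have : (fun q : (Fin n → ℝ≥0) × (Fin n → ℝ≥0) => obsEvent q.1 q.2 i) ⁻¹' {true} =
      {q | q.1 i < q.2 i} := by
    ext q
    simp [obsEvent]
  rw [this]
  exact measurableSet_lt (by fun_prop) (by fun_prop)

end Measurability

/-! ### Joint law of covariates, lifetimes and censoring times -/

section Law

variable {n : ℕ} {Ω E F : Type*} [mΩ : MeasurableSpace Ω] [MeasurableSpace E] [MeasurableSpace F]
  {P : Measure Ω} [IsProbabilityMeasure P]

/-- If the conditional probability of an event is constant, then the event is independent of the
conditioning. -/
theorem measure_inter_of_condExp_eq_const {m : MeasurableSpace Ω} (hm : m ≤ mΩ) {s A : Set Ω}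
    (hs : MeasurableSet[m] s) (hA : MeasurableSet[mΩ] A) {c : ℝ≥0∞} (hc : c ≠ ∞)
    (h : P⟦A | m⟧ =ᵐ[P] fun _ => c.toReal) : P (s ∩ A) = P s * c := by
  have h1 : ∫ ω in s, (P⟦A | m⟧) ω ∂P = ∫ ω in s, A.indicator (fun _ => (1 : ℝ)) ω ∂P :=
    setIntegral_condExp hm ((integrable_const 1).indicator hA) hs
  rw [setIntegral_congr_ae (hm _ hs) (h.mono fun ω hω _ => hω), setIntegral_indicator hA] at h1
  simp only [setIntegral_const, smul_eq_mul, mul_one, measureReal_def] at h1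
  rw [← ENNReal.toReal_mul, eq_comm] at h1
  exact (ENNReal.toReal_eq_toReal_iff' (measure_ne_top _ _)
    (ENNReal.mul_ne_top (measure_ne_top _ _) hc)).mp h1

theorem condExp_eq_const_of_measure_inter {m : MeasurableSpace Ω} (hm : m ≤ mΩ) {A : Set Ω}
    (hA : MeasurableSet[mΩ] A) {c : ℝ≥0∞}
    (h : ∀ s, MeasurableSet[m] s → P (s ∩ A) = P s * c) :
    P⟦A | m⟧ =ᵐ[P] fun _ => c.toReal := by
  symm
  refine ae_eq_condExp_of_forall_setIntegral_eq hm ((integrable_const 1).indicator hA)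
    (fun s _ _ => (integrable_const _).integrableOn) (fun s hs _ => ?_)
    aestronglyMeasurable_const
  rw [setIntegral_indicator hA]
  simp only [setIntegral_const, smul_eq_mul, mul_one, measureReal_def]
  rw [h s hs, ENNReal.toReal_mul]

theorem condExp_preimage_of_indepFun {X : Ω → E} {Y : Ω → F} (hX : Measurable X)
    (hY : Measurable Y) (h : IndepFun X Y P) {s : Set F} (hs : MeasurableSet s) :
    P⟦Y ⁻¹' s | MeasurableSpace.comap X inferInstance⟧ =ᵐ[P] fun _ => (P.map Y s).toReal := by
  refine condExp_eq_const_of_measure_inter hX.comap_le (hY hs) ?_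
  rintro _ ⟨t, ht, rfl⟩
  rw [h.measure_inter_preimage_eq_mul _ _ ht hs, Measure.map_apply hY hs]

/-- Given the covariates, the pairs `(T i, C i)` have the law `⨂ i, (law of T i) ⊗ (law of C i)`. -/
theorem map_prodMk_eq [StandardBorelSpace Ω] {X : Ω → E} {T C : Ω → Fin n → ℝ≥0}
    (hX : Measurable X) (hT : Measurable T) (hC : Measurable C)
    (hTC : iCondIndepFun (MeasurableSpace.comap X inferInstance) hX.comap_le
      (fun i ω => (T ω i, C ω i)) P)
    (hTC' : ∀ i, CondIndepFun (MeasurableSpace.comap X inferInstance) hX.comap_le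
      (fun ω => T ω i) (fun ω => C ω i) P)
    (hXT : ∀ i, IndepFun X (fun ω => T ω i) P) (hXC : ∀ i, IndepFun X (fun ω => C ω i) P) :
    P.map (fun ω => (X ω, fun i => (T ω i, C ω i))) =
      (P.map X).prod (Measure.pi fun i =>
        (P.map fun ω => T ω i).prod (P.map fun ω => C ω i)) := by
  have hTi : ∀ i, Measurable fun ω => T ω i := fun i => (measurable_pi_apply i).comp hT
  have hCi : ∀ i, Measurable fun ω => C ω i := fun i => (measurable_pi_apply i).comp hC
  have hWi : ∀ i, Measurable fun ω => (T ω i, C ω i) := fun i => (hTi i).prodMk (hCi i)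
  have hW : Measurable fun ω => fun i => (T ω i, C ω i) := measurable_pi_lambda _ hWi
  have hpT : ∀ i, IsProbabilityMeasure (P.map fun ω => T ω i) := fun i =>
    Measure.isProbabilityMeasure_map (hTi i).aemeasurable
  have hpC : ∀ i, IsProbabilityMeasure (P.map fun ω => C ω i) := fun i =>
    Measure.isProbabilityMeasure_map (hCi i).aemeasurable
  have hpX : IsProbabilityMeasure (P.map X) := Measure.isProbabilityMeasure_map hX.aemeasurable
  set κ : Fin n → Measure (ℝ≥0 × ℝ≥0) := fun i =>
    (P.map fun ω => T ω i).prod (P.map fun ω => C ω i) with hκ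
  have hpκ : ∀ i, IsProbabilityMeasure (κ i) := fun i => by rw [hκ]; infer_instance
  -- the law of one pair given the covariates
  have hpair : ∀ i (s : Set E), MeasurableSet s → ∀ t, MeasurableSet t →
      P (X ⁻¹' s ∩ (fun ω => (T ω i, C ω i)) ⁻¹' t) = P (X ⁻¹' s) * κ i t := by
    intro i s hs t ht
    -- Restricting to `X ⁻¹' s` gives finite measures, which need only be compared on the π-system
    -- of rectangles; there conditional independence and the constant conditional marginals apply.
    have key : (P.restrict (X ⁻¹' s)).map (fun ω => (T ω i, C ω i)) = P (X ⁻¹' s) • κ i := by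
      have hrect : ∀ u v, MeasurableSet u → MeasurableSet v →
          (P.restrict (X ⁻¹' s)).map (fun ω => (T ω i, C ω i)) (u ×ˢ v) =
            (P (X ⁻¹' s) • κ i) (u ×ˢ v) := by
        intro u v hu hv
        rw [Measure.map_apply (hWi i) (hu.prod hv),
          Measure.restrict_apply (hWi i (hu.prod hv)), Set.inter_comm, Measure.smul_apply,
          smul_eq_mul, hκ, Measure.prod_prod]
        have h1 := (condIndepFun_iff_condExp_inter_preimage_eq_mul (hTi i) (hCi i)).mp (hTC' i)
          u v hu hv
        refine measure_inter_of_condExp_eq_const hX.comap_le ⟨s, hs, rfl⟩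
          (hWi i (hu.prod hv)) (ENNReal.mul_ne_top (measure_ne_top _ _) (measure_ne_top _ _)) ?_
        refine h1.trans ?_
        filter_upwards [condExp_preimage_of_indepFun hX (hTi i) (hXT i) hu,
          condExp_preimage_of_indepFun hX (hCi i) (hXC i) hv] with ω h2 h3
        rw [h2, h3, ENNReal.toReal_mul]
      refine ext_of_generate_finite _ generateFrom_prod.symm isPiSystem_prod ?_ ?_
      · rintro _ ⟨u, hu, v, hv, rfl⟩
        exact hrect u v hu hv
      · rw [← Set.univ_prod_univ]
        exact hrect _ _ MeasurableSet.univ MeasurableSet.univ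
    rw [Set.inter_comm, ← Measure.restrict_apply (hWi i ht), ← Measure.map_apply (hWi i) ht, key]
    rfl
  symm
  refine Measure.prod_eq fun s t hs ht => ?_
  rw [Measure.map_apply (hX.prodMk hW) (hs.prod ht), Set.mk_preimage_prod,
    Measure.map_apply hX hs]
  -- The same argument one level up: boxes in the product over individuals, with `hpair` supplying
  -- the constant conditional laws of the pairs.
  have key : (P.restrict (X ⁻¹' s)).map (fun ω => fun i => (T ω i, C ω i)) =
      P (X ⁻¹' s) • Measure.pi κ := by
    have hrect : ∀ u : Fin n → Set (ℝ≥0 × ℝ≥0), (∀ i, MeasurableSet (u i)) →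
        (P.restrict (X ⁻¹' s)).map (fun ω => fun i => (T ω i, C ω i)) (Set.univ.pi u) =
          (P (X ⁻¹' s) • Measure.pi κ) (Set.univ.pi u) := by
      intro u hu
      have hum := MeasurableSet.univ_pi hu
      rw [Measure.map_apply hW hum, Measure.restrict_apply (hW hum), Set.inter_comm,
        Measure.smul_apply, smul_eq_mul, Measure.pi_pi]
      refine measure_inter_of_condExp_eq_const hX.comap_le ⟨s, hs, rfl⟩ (hW hum)
        (ENNReal.prod_ne_top fun i _ => measure_ne_top _ _) ?_
      have h1 := (iCondIndepFun_iff_condExp_inter_preimage_eq_mul _ _ hWi).mp hTC Finset.univ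
        (sets := u) fun i _ => hu i
      have h2 : (fun ω => fun i => (T ω i, C ω i)) ⁻¹' Set.univ.pi u =
          ⋂ i ∈ Finset.univ, (fun ω => (T ω i, C ω i)) ⁻¹' u i := by
        ext ω
        simp [Set.mem_pi]
      rw [h2]
      refine h1.trans ?_
      have h3 : ∀ i, P⟦(fun ω => (T ω i, C ω i)) ⁻¹' u i |
          MeasurableSpace.comap X inferInstance⟧ =ᵐ[P] fun _ => (κ i (u i)).toReal := by
        intro i
        refine condExp_eq_const_of_measure_inter hX.comap_le (hWi i (hu i)) ?_
        rintro _ ⟨s', hs', rfl⟩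
        exact hpair i s' hs' _ (hu i)
      filter_upwards [ae_all_iff.mpr h3] with ω h4
      rw [Finset.prod_apply, ENNReal.toReal_prod]
      exact Finset.prod_congr rfl fun i _ => h4 i
    refine ext_of_generate_finite _ generateFrom_pi.symm isPiSystem_pi ?_ ?_
    · rintro _ ⟨u, hu, rfl⟩
      exact hrect u fun i => hu i trivial
    · have h := hrect (fun _ => Set.univ) fun _ => MeasurableSet.univ
      rwa [Set.pi_univ] at h
  rw [Set.inter_comm, ← Measure.restrict_apply (hW ht), ← Measure.map_apply hW ht, key]
  rfl

theorem map_pi_comp_perm {κ : Fin n → Measure F} [∀ i, IsProbabilityMeasure (κ i)]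
    (hκ : ∀ i j, κ i = κ j) (g : Equiv.Perm (Fin n)) :
    (Measure.pi κ).map (fun w => w ∘ g) = Measure.pi κ := by
  have hm : Measurable fun w : Fin n → F => w ∘ g :=
    measurable_pi_lambda _ fun i => measurable_pi_apply (g i)
  symm
  refine Measure.pi_eq fun s hs => ?_
  rw [Measure.map_apply hm (MeasurableSet.univ_pi hs)]
  have : (fun w : Fin n → F => w ∘ g) ⁻¹' Set.univ.pi s = Set.univ.pi fun i => s (g.symm i) := by
    ext w
    simp only [Set.mem_preimage, Set.mem_univ_pi, Function.comp_apply]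
    exact ⟨fun h i => by simpa using h (g.symm i), fun h i => by simpa using h (g i)⟩
  rw [this, Measure.pi_pi, ← Equiv.prod_comp g]
  exact Finset.prod_congr rfl fun i _ => by rw [g.symm_apply_apply, hκ (g i) i]

/-- Under the null hypothesis, the lifetimes and censoring times are jointly exchangeable given the
covariates. -/
theorem map_comp_perm_eq [StandardBorelSpace Ω] {X : Ω → Fin n → E} {T C : Ω → Fin n → ℝ≥0}
    (hX : Measurable X) (hT : Measurable T) (hC : Measurable C)
    (hTC : iCondIndepFun (MeasurableSpace.comap X inferInstance) hX.comap_le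
      (fun i ω => (T ω i, C ω i)) P)
    (hTC' : ∀ i, CondIndepFun (MeasurableSpace.comap X inferInstance) hX.comap_le
      (fun ω => T ω i) (fun ω => C ω i) P)
    (hXT : IndepOfCovariate P X T) (hXC : IndepOfCovariate P X C) (g : Equiv.Perm (Fin n)) :
    P.map (fun ω => (X ω, T ω ∘ g, C ω ∘ g)) = P.map fun ω => (X ω, T ω, C ω) := by
  have hTi : ∀ i, Measurable fun ω => T ω i := fun i => (measurable_pi_apply i).comp hT
  have hCi : ∀ i, Measurable fun ω => C ω i := fun i => (measurable_pi_apply i).comp hC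
  have hpT : ∀ i, IsProbabilityMeasure (P.map fun ω => T ω i) := fun i =>
    Measure.isProbabilityMeasure_map (hTi i).aemeasurable
  have hpC : ∀ i, IsProbabilityMeasure (P.map fun ω => C ω i) := fun i =>
    Measure.isProbabilityMeasure_map (hCi i).aemeasurable
  have hpX : IsProbabilityMeasure (P.map X) := Measure.isProbabilityMeasure_map hX.aemeasurable
  have hW : Measurable fun ω => (X ω, fun i => (T ω i, C ω i)) :=
    hX.prodMk (measurable_pi_lambda _ fun i => (hTi i).prodMk (hCi i))
  have hlaw := map_prodMk_eq hX hT hC hTC hTC' hXT.1 hXC.1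
  have hg : Measurable fun w : Fin n → ℝ≥0 × ℝ≥0 => w ∘ g :=
    measurable_pi_lambda _ fun i => measurable_pi_apply (g i)
  have hinv : (P.map fun ω => (X ω, fun i => (T ω i, C ω i))).map
      (Prod.map id fun w : Fin n → ℝ≥0 × ℝ≥0 => w ∘ g) =
        P.map fun ω => (X ω, fun i => (T ω i, C ω i)) := by
    rw [hlaw, ← Measure.map_prod_map _ _ measurable_id hg, Measure.map_id, map_pi_comp_perm]
    intro i j
    rw [(hXT.2 i j).map_eq, (hXC.2 i j).map_eq]
  have hsplit : Measurable fun q : (Fin n → E) × (Fin n → ℝ≥0 × ℝ≥0) =>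
      (q.1, (fun i => (q.2 i).1), fun i => (q.2 i).2) := by
    fun_prop
  have h := congrArg (fun μ => μ.map fun q : (Fin n → E) × (Fin n → ℝ≥0 × ℝ≥0) =>
      (q.1, (fun i => (q.2 i).1), fun i => (q.2 i).2)) hinv
  beta_reduce at h
  rw [Measure.map_map (measurable_id.prodMap hg) hW, Measure.map_map hsplit hW,
    Measure.map_map hsplit ((measurable_id.prodMap hg).comp hW)] at h
  exact h

end Law

/-! ### Integrating out a random output with given conditional law -/

section Disintegration

variable {Ω β ι : Type*} [mΩ : MeasurableSpace Ω] [MeasurableSpace β] [Fintype ι]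
  [MeasurableSpace ι] [MeasurableSingletonClass ι] {P : Measure Ω}

theorem map_restrict_eq_withDensity [IsProbabilityMeasure P] {Y : Ω → β} (hY : Measurable Y) {A : Set Ω}
    (hA : MeasurableSet A) {p : β → ℝ≥0∞} (hp : Measurable p) (hp1 : ∀ y, p y ≤ 1)
    (h : P⟦A | MeasurableSpace.comap Y inferInstance⟧ =ᵐ[P] fun ω => (p (Y ω)).toReal) :
    (P.restrict A).map Y = (P.map Y).withDensity p := by
  ext s hs
  rw [Measure.map_apply hY hs, Measure.restrict_apply (hY hs), withDensity_apply _ hs,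
    setLIntegral_map hs hp hY]
  have h1 : ∫ ω in Y ⁻¹' s, (P⟦A | MeasurableSpace.comap Y inferInstance⟧) ω ∂P =
      ∫ ω in Y ⁻¹' s, A.indicator (fun _ => (1 : ℝ)) ω ∂P :=
    setIntegral_condExp hY.comap_le ((integrable_const 1).indicator hA) ⟨s, hs, rfl⟩
  rw [setIntegral_congr_ae (hY hs) (h.mono fun ω hω _ => hω), setIntegral_indicator hA,
    integral_toReal (f := fun ω => p (Y ω)) (hp.comp hY).aemeasurable
      (Filter.Eventually.of_forall fun ω => (hp1 _).trans_lt ENNReal.one_lt_top)] at h1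
  simp only [setIntegral_const, smul_eq_mul, mul_one, measureReal_def] at h1
  refine ((ENNReal.toReal_eq_toReal_iff' ?_ (measure_ne_top _ _)).mp h1).symm
  refine ne_top_of_le_ne_top (measure_ne_top P (Y ⁻¹' s)) ?_
  calc ∫⁻ ω in Y ⁻¹' s, p (Y ω) ∂P ≤ ∫⁻ _ in Y ⁻¹' s, 1 ∂P := lintegral_mono fun ω => hp1 _
    _ = P (Y ⁻¹' s) := by simp

theorem lintegral_eq_sum_indicator {a : Ω → ι} (ha : Measurable a) {G : ι → Ω → ℝ≥0∞}
    (hG : ∀ i, Measurable (G i)) :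
    ∫⁻ ω, G (a ω) ω ∂P = ∑ i, ∫⁻ ω in a ⁻¹' {i}, G i ω ∂P := by
  classical
  have h : ∀ ω, G (a ω) ω = ∑ i, (a ⁻¹' {i}).indicator (G i) ω := by
    intro ω
    rw [Finset.sum_eq_single (a ω)]
    · simp
    · intro i _ hi
      exact Set.indicator_of_notMem (fun hm => hi hm.symm) _
    · simp
  simp only [h]
  rw [lintegral_finsetSum _ fun i _ => (hG i).indicator (ha (measurableSet_singleton i))]
  exact Finset.sum_congr rfl fun i _ => lintegral_indicator (ha (measurableSet_singleton i)) _

/-- On `a = i` the law of `Y` has density `p i`, so the random choice `a` can be replaced by its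
conditional mean. This links the random output of the transformation to sums against `transformLaw`.
-/
theorem lintegral_eq_lintegral_sum [IsProbabilityMeasure P] {Y : Ω → β} (hY : Measurable Y) {a : Ω → ι}
    (ha : Measurable a) {p : ι → β → ℝ≥0∞} (hp : ∀ i, Measurable (p i)) (hp1 : ∀ i y, p i y ≤ 1)
    (h : ∀ i, P⟦a ⁻¹' {i} | MeasurableSpace.comap Y inferInstance⟧ =ᵐ[P]
      fun ω => (p i (Y ω)).toReal) {G : ι → β → ℝ≥0∞} (hG : ∀ i, Measurable (G i)) :
    ∫⁻ ω, G (a ω) (Y ω) ∂P = ∫⁻ y, ∑ i, p i y * G i y ∂(P.map Y) := by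
  rw [lintegral_eq_sum_indicator ha (G := fun i ω => G i (Y ω)) fun i => (hG i).comp hY,
    lintegral_finsetSum (f := fun i y => p i y * G i y) _ fun i _ => (hp i).mul (hG i)]
  refine Finset.sum_congr rfl fun i _ => ?_
  rw [← lintegral_map (hG i) hY,
    map_restrict_eq_withDensity hY (ha (measurableSet_singleton i)) (hp i) (hp1 i) (h i),
    lintegral_withDensity_eq_lintegral_mul _ (hp i) (hG i)]
  rfl

end Disintegration

/-! ### Exchangeability given the covariates and uniformity of the rank -/

section Test

variable {n d B : ℕ} {Ω : Type*} [mΩ : MeasurableSpace Ω] {P : Measure Ω}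

/-- Given the covariates, the times which the transformation assigns are exchangeable. -/
theorem lintegral_transform_comp_perm [IsProbabilityMeasure P] {X : Ω → Fin n → Cov d} {T C : Ω → Fin n → ℝ≥0}
    (hX : Measurable X) (hT : Measurable T) (hC : Measurable C)
    (hlaw : ∀ g : Equiv.Perm (Fin n),
      P.map (fun ω => (X ω, T ω ∘ g, C ω ∘ g)) = P.map fun ω => (X ω, T ω, C ω))
    {plan : (Fin n → Cov d) → Finset (Fin n) → Finset (Fin n) → PMF (Fin n × Fin n)}
    (hplan : IsOptimalPlan plan) {a : Ω → Fin n → Fin n} (ha : Measurable a)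
    (ha_law : ∀ a₀ : Fin n → Fin n,
      P⟦a ⁻¹' {a₀} | MeasurableSpace.comap (fun ω => (X ω, T ω, C ω)) inferInstance⟧ =ᵐ[P]
        fun ω => (transformLaw plan (X ω) (obsTime (T ω) (C ω)) (obsEvent (T ω) (C ω)) a₀).toReal)
    {G : (Fin n → Cov d) × (Fin n → ℝ≥0) → ℝ≥0∞} (hG : Measurable G) (h : Equiv.Perm (Fin n)) :
    ∫⁻ ω, G (X ω, (obsTime (T ω) (C ω) ∘ a ω) ∘ h) ∂P =
      ∫⁻ ω, G (X ω, obsTime (T ω) (C ω) ∘ a ω) ∂P := by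
  have hY : Measurable fun ω => (X ω, T ω, C ω) := hX.prodMk (hT.prodMk hC)
  let Γ := (Fin n → Cov d) × (Fin n → ℝ≥0) × (Fin n → ℝ≥0)
  have hz : Measurable fun y : Γ => obsTime y.2.1 y.2.2 := measurable_obsTime.comp measurable_snd
  let p : (Fin n → Fin n) → Γ → ℝ≥0∞ := fun a₀ y =>
    transformLaw plan y.1 (obsTime y.2.1 y.2.2) (obsEvent y.2.1 y.2.2) a₀
  have hp : ∀ a₀, Measurable (p a₀) := fun a₀ => measurable_transformLaw hplan measurable_fst hz
    (measurable_obsEvent.comp measurable_snd) a₀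
  let Ψ : ((Fin n → Cov d) × (Fin n → ℝ≥0) → ℝ≥0∞) → Γ → ℝ≥0∞ := fun G y =>
    ∑ a₀, p a₀ y * G (y.1, obsTime y.2.1 y.2.2 ∘ a₀)
  have hcomp : ∀ a₀ : Fin n → Fin n, Measurable fun t : Fin n → ℝ≥0 => t ∘ a₀ := fun a₀ =>
    measurable_pi_lambda _ fun i => measurable_pi_apply (a₀ i)
  have hGa : ∀ G : (Fin n → Cov d) × (Fin n → ℝ≥0) → ℝ≥0∞, Measurable G → ∀ a₀ : Fin n → Fin n,
      Measurable fun y : Γ => G (y.1, obsTime y.2.1 y.2.2 ∘ a₀) := fun G hG a₀ =>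
    hG.comp (measurable_fst.prodMk ((hcomp a₀).comp hz))
  have hΨ : ∀ G, Measurable G → Measurable (Ψ G) := fun G hG =>
    Finset.measurable_sum _ fun a₀ _ => (hp a₀).mul (hGa G hG a₀)
  have hint : ∀ G, Measurable G → ∫⁻ ω, G (X ω, obsTime (T ω) (C ω) ∘ a ω) ∂P =
      ∫⁻ ω, Ψ G (X ω, T ω, C ω) ∂P := by
    intro G hG
    rw [← lintegral_map (hΨ G hG) hY]
    exact lintegral_eq_lintegral_sum hY ha hp (fun a₀ y => PMF.coe_le_one _ _) ha_law
      (G := fun a₀ y => G (y.1, obsTime y.2.1 y.2.2 ∘ a₀)) (hGa G hG)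
  -- Each rearrangement `g` leaves the law unchanged, so the integral may be averaged over all `g`;
  -- this produces the sum in `sum_perm_transformLaw_comp`.
  have hsym : ∀ G, Measurable G →
      (Fintype.card (Equiv.Perm (Fin n)) : ℝ≥0∞) * ∫⁻ ω, Ψ G (X ω, T ω, C ω) ∂P =
        ∫⁻ ω, ∑ g : Equiv.Perm (Fin n), Ψ G (X ω, T ω ∘ g, C ω ∘ g) ∂P := by
    intro G hG
    have hYg : ∀ g : Equiv.Perm (Fin n), Measurable fun ω => (X ω, T ω ∘ g, C ω ∘ g) := fun g =>
      hX.prodMk (((hcomp g).comp hT).prodMk ((hcomp g).comp hC))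
    rw [lintegral_finsetSum (f := fun (g : Equiv.Perm (Fin n)) ω => Ψ G (X ω, T ω ∘ g, C ω ∘ g)) _
      fun g _ => (hΨ G hG).comp (hYg g)]
    have : ∀ g : Equiv.Perm (Fin n), ∫⁻ ω, Ψ G (X ω, T ω ∘ g, C ω ∘ g) ∂P =
        ∫⁻ ω, Ψ G (X ω, T ω, C ω) ∂P := by
      intro g
      rw [← lintegral_map (hΨ G hG) hY, ← hlaw g, lintegral_map (hΨ G hG) (hYg g)]
    rw [Finset.sum_congr rfl fun g _ => this g, Finset.sum_const, nsmul_eq_mul]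
    rfl
  have hGh : Measurable fun q : (Fin n → Cov d) × (Fin n → ℝ≥0) => G (q.1, q.2 ∘ h) :=
    hG.comp (measurable_fst.prodMk ((hcomp h).comp measurable_snd))
  rw [hint _ hG, hint _ hGh]
  refine (ENNReal.mul_right_inj (a := (Fintype.card (Equiv.Perm (Fin n)) : ℝ≥0∞))
    (Nat.cast_ne_zero.mpr Fintype.card_ne_zero) (ENNReal.natCast_ne_top _)).mp ?_
  rw [hsym _ hG, hsym _ hGh]
  refine lintegral_congr fun ω => ?_
  exact sum_perm_transformLaw_comp hplan (X ω) (obsTime (T ω) (C ω)) (obsEvent (T ω) (C ω))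
    (fun t => G (X ω, t)) h

theorem measurable_rankFirst_testVector {H : Multiset (Cov d × ℝ≥0) → ℝ}
    (hH : Measurable fun q : (Fin n → Cov d) × (Fin n → ℝ≥0) => H (dataset q.1 q.2)) :
    Measurable fun q : ((Fin n → Cov d) × (Fin n → ℝ≥0)) ×
        ((Fin B → Equiv.Perm (Fin n)) × Equiv.Perm (Fin (B + 1))) =>
      rankFirst (testVector H q.1.1 q.1.2 q.2.1) q.2.2 := by
  classical
  refine measurable_from_prod_countable_left fun q => ?_
  have hv : ∀ j, Measurable fun p : (Fin n → Cov d) × (Fin n → ℝ≥0) =>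
      testVector H p.1 p.2 q.1 j := by
    intro j
    refine Fin.cases hH (fun b => ?_) j
    have hc : Measurable fun x : Fin n → Cov d => x ∘ q.1 b :=
      measurable_pi_lambda _ fun i => measurable_pi_apply (q.1 b i)
    exact hH.comp ((hc.comp measurable_fst).prodMk measurable_snd)
  simp only [rankFirst, Finset.card_filter]
  refine Finset.measurable_sum _ fun j _ => Measurable.ite ?_ measurable_const measurable_const
  exact (measurableSet_lt (hv j) (hv 0)).union
    ((measurableSet_eq_fun (hv j) (hv 0)).inter (MeasurableSet.const _))

theorem measure_preimage_singleton_of_uniform {m : ℕ} {σ : Ω → Equiv.Perm (Fin m)}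
    (hσ : Measurable σ) (hu : P.map σ = uniformOn Set.univ) (s : Equiv.Perm (Fin m)) :
    P (σ ⁻¹' {s}) = (Fintype.card (Equiv.Perm (Fin m)) : ℝ≥0∞)⁻¹ := by
  rw [← Measure.map_apply hσ (measurableSet_singleton s), hu, uniformOn_univ,
    Measure.count_singleton, one_div]

/-- Integrating out the uniform permutations and the uniform tie breaking order. -/
theorem measure_inter_perm [IsProbabilityMeasure P] {V : Type*} [MeasurableSpace V] {Y : Ω → V}
    {π : Fin B → Ω → Equiv.Perm (Fin n)} (hπ : ∀ b, Measurable (π b))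
    (hπ_unif : ∀ b, P.map (π b) = uniformOn Set.univ) (hπ_indep : iIndepFun π P)
    (hπ_data : IndepFun (fun ω b => π b ω) Y P)
    {σ : Ω → Equiv.Perm (Fin (B + 1))} (hσ : Measurable σ)
    (hσ_unif : P.map σ = uniformOn Set.univ)
    (hσ_indep : IndepFun σ (fun ω => (Y ω, fun b => π b ω)) P)
    {S : Set V} (hS : MeasurableSet S)
    (q : (Fin B → Equiv.Perm (Fin n)) × Equiv.Perm (Fin (B + 1))) :
    P ((fun ω => ((fun b => π b ω), σ ω)) ⁻¹' {q} ∩ Y ⁻¹' S) =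
      (Fintype.card ((Fin B → Equiv.Perm (Fin n)) × Equiv.Perm (Fin (B + 1))) : ℝ≥0∞)⁻¹ *
        P (Y ⁻¹' S) := by
  have h1 : (fun ω => ((fun b => π b ω), σ ω)) ⁻¹' {q} ∩ Y ⁻¹' S =
      σ ⁻¹' {q.2} ∩ (fun ω => (Y ω, fun b => π b ω)) ⁻¹' (S ×ˢ {q.1}) := by
    ext ω
    simp only [Set.mem_inter_iff, Set.mem_preimage, Set.mem_singleton_iff, Prod.ext_iff,
      Set.mem_prod]
    tauto
  have h2 : (fun ω => (Y ω, fun b => π b ω)) ⁻¹' (S ×ˢ {q.1}) =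
      (fun ω b => π b ω) ⁻¹' {q.1} ∩ Y ⁻¹' S := by
    ext ω
    simp only [Set.mem_inter_iff, Set.mem_preimage, Set.mem_singleton_iff, Set.mem_prod]
    tauto
  have h3 : (fun ω b => π b ω) ⁻¹' {q.1} = ⋂ b ∈ Finset.univ, π b ⁻¹' {q.1 b} := by
    ext ω
    simp [funext_iff]
  rw [h1, hσ_indep.measure_inter_preimage_eq_mul _ _ (measurableSet_singleton _)
    (hS.prod (measurableSet_singleton _)), h2,
    hπ_data.measure_inter_preimage_eq_mul _ _ (measurableSet_singleton _) hS, h3,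
    hπ_indep.measure_inter_preimage_eq_mul Finset.univ fun b _ => measurableSet_singleton _,
    measure_preimage_singleton_of_uniform hσ hσ_unif,
    Finset.prod_congr rfl fun b _ => measure_preimage_singleton_of_uniform (hπ b) (hπ_unif b) _,
    Finset.prod_const, Finset.card_univ, Fintype.card_fin, Fintype.card_prod, Fintype.card_fun,
    Fintype.card_fin, Nat.cast_mul, Nat.cast_pow, ENNReal.mul_inv (Or.inr (by simp))
      (Or.inl (by simp)), ENNReal.inv_pow, ← mul_assoc]
  congr 1
  exact mul_comm _ _

/-- If the times are exchangeable given the covariates, then given the covariates every rank is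
equally likely. -/
theorem measure_rankFirst_eq [IsProbabilityMeasure P] {X : Ω → Fin n → Cov d} {t : Ω → Fin n → ℝ≥0}
    (hX : Measurable X) (ht : Measurable t)
    (hexch : ∀ G : (Fin n → Cov d) × (Fin n → ℝ≥0) → ℝ≥0∞, Measurable G →
      ∀ h : Equiv.Perm (Fin n), ∫⁻ ω, G (X ω, t ω ∘ h) ∂P = ∫⁻ ω, G (X ω, t ω) ∂P)
    {ρ : Ω → (Fin B → Equiv.Perm (Fin n)) × Equiv.Perm (Fin (B + 1))} (hρ : Measurable ρ)
    (hind : ∀ S : Set ((Fin n → Cov d) × (Fin n → ℝ≥0)), MeasurableSet S → ∀ q,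
      P (ρ ⁻¹' {q} ∩ (fun ω => (X ω, t ω)) ⁻¹' S) =
        (Fintype.card ((Fin B → Equiv.Perm (Fin n)) × Equiv.Perm (Fin (B + 1))) : ℝ≥0∞)⁻¹ *
          P ((fun ω => (X ω, t ω)) ⁻¹' S))
    {H : Multiset (Cov d × ℝ≥0) → ℝ}
    (hH : Measurable fun q : (Fin n → Cov d) × (Fin n → ℝ≥0) => H (dataset q.1 q.2))
    {E : Set (Fin n → Cov d)} (hE : MeasurableSet E) {k : ℕ} (hk : k ∈ Finset.Icc 1 (B + 1)) :
    P (X ⁻¹' E ∩ {ω | rankFirst (testVector H (X ω) (t ω) (ρ ω).1) (ρ ω).2 = k}) =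
      P (X ⁻¹' E) * ((B + 1 : ℕ) : ℝ≥0∞)⁻¹ := by
  classical
  set K := Fintype.card ((Fin B → Equiv.Perm (Fin n)) × Equiv.Perm (Fin (B + 1))) with hK
  set N := Fintype.card (Equiv.Perm (Fin n)) with hN
  have hK0 : (K : ℝ≥0∞) ≠ 0 := Nat.cast_ne_zero.mpr Fintype.card_ne_zero
  have hN0 : (N : ℝ≥0∞) ≠ 0 := Nat.cast_ne_zero.mpr Fintype.card_ne_zero
  have hXt : Measurable fun ω => (X ω, t ω) := hX.prodMk ht
  let M : (Fin B → Equiv.Perm (Fin n)) × Equiv.Perm (Fin (B + 1)) →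
      Set ((Fin n → Cov d) × (Fin n → ℝ≥0)) := fun q =>
    {p | p.1 ∈ E ∧ rankFirst (testVector H p.1 p.2 q.1) q.2 = k}
  have hM : ∀ q, MeasurableSet (M q) := fun q =>
    (measurable_fst hE).inter (((measurable_rankFirst_testVector hH).comp
      (measurable_id.prodMk measurable_const)) (measurableSet_singleton k))
  -- For given covariates in `E` and given times, `G` counts the choices of permutations and
  -- tie-breaking order that produce rank `k`.
  let G : (Fin n → Cov d) × (Fin n → ℝ≥0) → ℝ≥0∞ := fun p => ∑ q, (M q).indicator 1 p
  have hG : Measurable G := Finset.measurable_sum _ fun q _ => measurable_one.indicator (hM q)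
  -- The count is constant only after summation over `h`; exchangeability in `hint` then removes
  -- that sum.
  have hGsum : ∀ ω, ((B + 1 : ℕ) : ℝ≥0∞) * ∑ h : Equiv.Perm (Fin n), G (X ω, t ω ∘ h) =
      (N * K : ℝ≥0∞) * (X ⁻¹' E).indicator 1 ω := by
    intro ω
    by_cases hω : X ω ∈ E
    · have h1 : ∀ h : Equiv.Perm (Fin n), G (X ω, t ω ∘ h) =
          (((Finset.univ.filter fun q : (Fin B → Equiv.Perm (Fin n)) × Equiv.Perm (Fin (B + 1)) =>
            rankFirst (testVector H (X ω) (t ω ∘ h) q.1) q.2 = k).card : ℕ) : ℝ≥0∞) := by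
        intro h
        rw [Finset.card_filter, Nat.cast_sum]
        refine Finset.sum_congr rfl fun q _ => ?_
        simp [M, Set.indicator_apply, hω]
      rw [Finset.sum_congr rfl fun h _ => h1 h, Set.indicator_of_mem (by exact hω)]
      have h2 := card_rankFirst_testVector (B := B) H (X ω) (t ω) hk
      rw [Pi.one_apply, mul_one]
      exact_mod_cast h2
    · rw [Set.indicator_of_notMem (by exact hω), mul_zero]
      refine mul_eq_zero_of_right _ (Finset.sum_eq_zero fun h _ => Finset.sum_eq_zero fun q _ => ?_)
      exact Set.indicator_of_notMem (fun hm => hω hm.1) _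
  have hGh : ∀ h : Equiv.Perm (Fin n), Measurable fun ω => G (X ω, t ω ∘ h) := fun h => by
    have hc : Measurable fun s : Fin n → ℝ≥0 => s ∘ h :=
      measurable_pi_lambda _ fun i => measurable_pi_apply (h i)
    exact hG.comp (hX.prodMk (hc.comp ht))
  have hint : ((B + 1 : ℕ) : ℝ≥0∞) * ∫⁻ ω, G (X ω, t ω) ∂P = K * P (X ⁻¹' E) := by
    refine (ENNReal.mul_right_inj hN0 (ENNReal.natCast_ne_top _)).mp ?_
    calc (N : ℝ≥0∞) * (((B + 1 : ℕ) : ℝ≥0∞) * ∫⁻ ω, G (X ω, t ω) ∂P)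
        = ((B + 1 : ℕ) : ℝ≥0∞) * ∑ h : Equiv.Perm (Fin n), ∫⁻ ω, G (X ω, t ω ∘ h) ∂P := by
          rw [Finset.sum_congr rfl fun h _ => hexch G hG h, Finset.sum_const, nsmul_eq_mul,
            mul_left_comm]
          rfl
      _ = ∫⁻ ω, ((B + 1 : ℕ) : ℝ≥0∞) * ∑ h : Equiv.Perm (Fin n), G (X ω, t ω ∘ h) ∂P := by
          rw [← lintegral_finsetSum _ fun h _ => hGh h,
            lintegral_const_mul _ (Finset.measurable_sum _ fun h _ => hGh h)]
      _ = N * (K * P (X ⁻¹' E)) := by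
          simp only [hGsum]
          rw [lintegral_const_mul _ (measurable_one.indicator (hX hE)),
            lintegral_indicator_one (hX hE), mul_assoc]
  have hGM : ∫⁻ ω, G (X ω, t ω) ∂P = ∑ q, P ((fun ω => (X ω, t ω)) ⁻¹' M q) := by
    rw [lintegral_finsetSum (f := fun q ω => (M q).indicator 1 (X ω, t ω)) _
      fun q _ => (measurable_one.indicator (hM q)).comp hXt]
    exact Finset.sum_congr rfl fun q _ => lintegral_indicator_one (hXt (hM q))
  have hsplit : X ⁻¹' E ∩ {ω | rankFirst (testVector H (X ω) (t ω) (ρ ω).1) (ρ ω).2 = k} =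
      ⋃ q ∈ Finset.univ, (ρ ⁻¹' {q} ∩ (fun ω => (X ω, t ω)) ⁻¹' M q) := by
    ext ω
    simp [M]
  rw [hsplit, measure_biUnion_finset]
  · rw [Finset.sum_congr rfl fun q _ => hind _ (hM q) q, ← Finset.mul_sum, ← hGM,
      ← div_eq_mul_inv, ENNReal.eq_div_iff (by simp) (ENNReal.natCast_ne_top _), mul_left_comm,
      hint, ← mul_assoc, ENNReal.inv_mul_cancel hK0 (ENNReal.natCast_ne_top _), one_mul]
  · intro q _ q' _ hqq
    refine Set.disjoint_left.mpr fun ω h1 h2 => hqq ?_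
    exact (Set.mem_singleton_iff.mp h1.1).symm.trans (Set.mem_singleton_iff.mp h2.1)
  · exact fun q _ => (hρ (measurableSet_singleton q)).inter (hXt (hM q))

end Test

end OPTTest

/-! ### The theorem: summing the uniform rank probabilities -/

open OPTTest in
theorem mainTheorem1 {n d B : ℕ} {Ω : Type*} [mΩ : MeasurableSpace Ω] [StandardBorelSpace Ω]
    (P : Measure Ω) [IsProbabilityMeasure P]
    -- covariates, lifetimes and censoring times
    (X : Ω → Fin n → OPTTest.Cov d) (T C : Ω → Fin n → ℝ≥0)
    (hX : Measurable X) (hT : Measurable T) (hC : Measurable C)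
    -- given the covariates, the pairs `(T i, C i)` are mutually independent
    (hTC : iCondIndepFun (MeasurableSpace.comap X inferInstance) hX.comap_le
      (fun i ω => (T ω i, C ω i)) P)
    -- given the covariates, `T i` and `C i` are independent
    (hTC' : ∀ i, CondIndepFun (MeasurableSpace.comap X inferInstance) hX.comap_le
      (fun ω => T ω i) (fun ω => C ω i) P)
    -- the null hypothesis, and independence of the censoring from the covariate
    (hH0 : OPTTest.IndepOfCovariate P X T)
    (hCX : OPTTest.IndepOfCovariate P X C)
    -- the optimal transport couplings
    (plan : (Fin n → OPTTest.Cov d) → Finset (Fin n) → Finset (Fin n) → PMF (Fin n × Fin n))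
    (hplan : OPTTest.IsOptimalPlan plan)
    -- the random output of the transformation applied to the observed data
    (a : Ω → Fin n → Fin n) (ha : Measurable a)
    (ha_law : ∀ a₀ : Fin n → Fin n,
      P⟦a ⁻¹' {a₀} | MeasurableSpace.comap (fun ω => (X ω, T ω, C ω)) inferInstance⟧ =ᵐ[P]
        fun ω => (OPTTest.transformLaw plan (X ω) (OPTTest.obsTime (T ω) (C ω))
          (OPTTest.obsEvent (T ω) (C ω)) a₀).toReal)
    -- independent uniform permutations, independent of the data and of the transformation
    (π : Fin B → Ω → Equiv.Perm (Fin n)) (hπ : ∀ b, Measurable (π b))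
    (hπ_unif : ∀ b, P.map (π b) = uniformOn Set.univ)
    (hπ_indep : iIndepFun π P)
    (hπ_data : IndepFun (fun ω b => π b ω) (fun ω => (X ω, T ω, C ω, a ω)) P)
    -- the independent uniform order by which ties in the rank are broken
    (σ : Ω → Equiv.Perm (Fin (B + 1))) (hσ : Measurable σ)
    (hσ_unif : P.map σ = uniformOn Set.univ)
    (hσ_indep : IndepFun σ (fun ω => (X ω, T ω, C ω, a ω, fun b => π b ω)) P)
    -- an arbitrary statistic of the dataset
    (H : Multiset (OPTTest.Cov d × ℝ≥0) → ℝ)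
    (hH : Measurable fun q : (Fin n → OPTTest.Cov d) × (Fin n → ℝ≥0) =>
      H (OPTTest.dataset q.1 q.2))
    -- the rank of the first coordinate
    (R : Ω → ℕ)
    (hR : ∀ ω, R ω = OPTTest.rankFirst (OPTTest.testVector H (X ω)
      (fun j => OPTTest.obsTime (T ω) (C ω) (a ω j)) (fun b => π b ω)) (σ ω))
    (α : ℝ) (hα₀ : 0 ≤ α) (hα₁ : α ≤ 1) :
    P.real {ω | (1 - α) * ((B : ℝ) + 1) + 1 ≤ (R ω : ℝ)}
        = (⌊α * ((B : ℝ) + 1)⌋ : ℝ) / ((B : ℝ) + 1) ∧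
      P⟦{ω | (1 - α) * ((B : ℝ) + 1) + 1 ≤ (R ω : ℝ)} |
          MeasurableSpace.comap X inferInstance⟧
        =ᵐ[P] (fun _ => (⌊α * ((B : ℝ) + 1)⌋ : ℝ) / ((B : ℝ) + 1)) ∧
      (⌊α * ((B : ℝ) + 1)⌋ : ℝ) / ((B : ℝ) + 1) ≤ α := by
  have hlaw := map_comp_perm_eq hX hT hC hTC hTC' hH0 hCX
  let t : Ω → Fin n → ℝ≥0 := fun ω => obsTime (T ω) (C ω) ∘ a ω
  have hout : Measurable fun q : (Fin n → ℝ≥0) × (Fin n → Fin n) => q.1 ∘ q.2 :=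
    measurable_from_prod_countable_left fun b =>
      measurable_pi_lambda _ fun i => measurable_pi_apply (b i)
  have hVt : Measurable fun v : (Fin n → Cov d) × (Fin n → ℝ≥0) × (Fin n → ℝ≥0) ×
      (Fin n → Fin n) => (v.1, obsTime v.2.1 v.2.2.1 ∘ v.2.2.2) :=
    measurable_fst.prodMk (hout.comp ((measurable_obsTime.comp (measurable_snd.fst.prodMk
      measurable_snd.snd.fst)).prodMk measurable_snd.snd.snd))
  have ht : Measurable t := (hVt.comp (hX.prodMk (hT.prodMk (hC.prodMk ha)))).snd
  let ρ : Ω → (Fin B → Equiv.Perm (Fin n)) × Equiv.Perm (Fin (B + 1)) :=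
    fun ω => ((fun b => π b ω), σ ω)
  have hρ : Measurable ρ := (measurable_pi_lambda _ hπ).prodMk hσ
  have hσ_indep' : IndepFun σ (fun ω => ((X ω, T ω, C ω, a ω), fun b => π b ω)) P := by
    have hm : Measurable fun v : (Fin n → Cov d) × (Fin n → ℝ≥0) × (Fin n → ℝ≥0) ×
        (Fin n → Fin n) × (Fin B → Equiv.Perm (Fin n)) =>
        ((v.1, v.2.1, v.2.2.1, v.2.2.2.1), v.2.2.2.2) := by fun_prop
    exact hσ_indep.comp measurable_id hm
  have hRt : ∀ ω, R ω = rankFirst (testVector H (X ω) (t ω) (ρ ω).1) (ρ ω).2 := hR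
  have hRm : Measurable R := by
    have h := (measurable_rankFirst_testVector (B := B) hH).comp ((hX.prodMk ht).prodMk hρ)
    rw [Function.comp_def] at h
    rw [funext hRt]
    exact h
  have hrank : ∀ E : Set (Fin n → Cov d), MeasurableSet E → ∀ k ∈ Finset.Icc 1 (B + 1),
      P (X ⁻¹' E ∩ {ω | R ω = k}) = P (X ⁻¹' E) * ((B + 1 : ℕ) : ℝ≥0∞)⁻¹ := by
    intro E hE k hk
    simp only [hRt]
    refine measure_rankFirst_eq hX ht (fun G hG h => ?_) hρ (fun S hS q => ?_) hH hE hk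
    · exact lintegral_transform_comp_perm hX hT hC hlaw hplan ha ha_law hG h
    · exact measure_inter_perm hπ hπ_unif hπ_indep hπ_data hσ hσ_unif hσ_indep' (hVt hS) q
  set A := (Finset.Icc 1 (B + 1)).filter fun k : ℕ => (1 - α) * ((B : ℝ) + 1) + 1 ≤ (k : ℝ)
    with hA
  have hevent : MeasurableSet {ω | (1 - α) * ((B : ℝ) + 1) + 1 ≤ (R ω : ℝ)} :=
    hRm (MeasurableSet.of_discrete (s := {k : ℕ | (1 - α) * ((B : ℝ) + 1) + 1 ≤ (k : ℝ)}))
  -- One identity serves both claims: `s = univ` gives the unconditional probability, and all `s`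
  -- together characterise the conditional one.
  have hmeas : ∀ s, MeasurableSet[MeasurableSpace.comap X inferInstance] s →
      P (s ∩ {ω | (1 - α) * ((B : ℝ) + 1) + 1 ≤ (R ω : ℝ)}) =
        P s * (A.card * ((B + 1 : ℕ) : ℝ≥0∞)⁻¹) := by
    rintro _ ⟨E, hE, rfl⟩
    have hsplit : X ⁻¹' E ∩ {ω | (1 - α) * ((B : ℝ) + 1) + 1 ≤ (R ω : ℝ)} =
        ⋃ k ∈ A, (X ⁻¹' E ∩ {ω | R ω = k}) := by
      ext ω
      have hmem : R ω ∈ Finset.Icc 1 (B + 1) := by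
        rw [hRt]
        exact rankAt_mem_Icc _ _ 0
      simp only [Set.mem_inter_iff, Set.mem_iUnion, exists_prop, hA, Finset.mem_filter]
      constructor
      · rintro ⟨h1, h2⟩
        exact ⟨R ω, ⟨hmem, h2⟩, h1, rfl⟩
      · rintro ⟨k, ⟨-, h2⟩, h1, rfl⟩
        exact ⟨h1, h2⟩
    rw [hsplit, measure_biUnion_finset]
    · rw [Finset.sum_congr rfl fun k hk => hrank E hE k (Finset.mem_filter.mp hk).1,
        Finset.sum_const, nsmul_eq_mul, mul_left_comm]
    · intro k _ k' _ hkk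
      exact Set.disjoint_left.mpr fun ω h1 h2 => hkk (h1.2.symm.trans h2.2)
    · exact fun k _ => (hX hE).inter (hRm (measurableSet_singleton k))
  have hc : ((A.card : ℝ≥0∞) * ((B + 1 : ℕ) : ℝ≥0∞)⁻¹).toReal =
      (⌊α * ((B : ℝ) + 1)⌋ : ℝ) / ((B : ℝ) + 1) := by
    rw [ENNReal.toReal_mul, ENNReal.toReal_inv, ENNReal.toReal_natCast, ENNReal.toReal_natCast,
      hA, card_filter_le_Icc B hα₀ hα₁, div_eq_mul_inv]
    push_cast
    rfl
  refine ⟨?_, ?_, ?_⟩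
  · rw [← hc, measureReal_def, ← Set.univ_inter {ω | _}, hmeas _ MeasurableSet.univ,
      measure_univ, one_mul]
  · rw [← hc]
    exact condExp_eq_const_of_measure_inter hX.comap_le hevent hmeas
  · rw [div_le_iff₀ (by positivity)]
    exact Int.floor_le _
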